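/- **Setting.** Let $n\ge 1$ parties $1,\dots,n$ each hold one qubit, and let $S$ be a stabilizer (an abelian subgroup of the $n$-qubit Pauli group) whose code space $\mathcal H^{(S)}$, the space of vectors fixed by all elements of $S$, is two-dimensional, with orthonormal logical basis $|0\rangle^{(S)},|1\rangle^{(S)}$. Let $R$ be a reference qubit and $|\Phi\rangle^{(RS)}=(|0\rangle^{(R)}|0\rangle^{(S)}+|1\rangle^{(R)}|1\rangle^{(S)})/\sqrt2$. For a graph $G=(V,E)$ on $V=\{R,1,\dots,n\}$ the graph state is $|G\rangle=\prod_{\{k,l\}\in E}CZ^{(kl)}\bigotimes_{k\in V}|+\rangle^{(k)}$. Suppose that $G$ is a tree and that $|\Phi\rangle^{(RS)}$ is LC equivalent to $|G\rangle$, i.e. $|G\rangle=\bigotimes_{k\in V}U_k\,|\Phi\rangle^{(RS)}$ up to a global phase, for some one-qubit Clifford unitaries $U_k$. A set $C$ of parties *can extract to party $j$* if there is an LOCC protocol (finitely many rounds of local quantum instruments, with local ancillas, whose outcomes are broadcast) in which only parties of $C$ act and which, whatever local operations the parties outside $C$ perform, maps every encoded state $\sum_{a,b}\rho_{ab}|a\rangle\langle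 b|^{(S)}$ to a state whose reduction to the qubit of $j$ is $\sum_{a,b}\rho_{ab}|a\rangle\langle b|^{(j)}$. **Theorem.** Let $j$ be a party, let $V_P$ be the vertex set of the path $v_1=j,v_2,\dots,v_L=R$ in $G$ (where $L=|V_P|$), and let $$W=\{k\in V:\ \{k,l\}\in E\ \text{for some}\ l\in V_P\}$$ (that is, all vertices on the path or adjacent to it). Then the minimum size of a set of parties that can extract to party $j$ equals $|W\setminus\{R\}|$; since $R\in W$, it is $|W|$ if the reference is counted as a (virtual) party, and $|W|-1$ otherwise. The minimum is attained by the following protocol, in which only the parties of $W\setminus\{R\}$ act. 1. Each party $k\in W\setminus\{R\}$ applies $U_k$. 2. Each party in $W\setminus V_P$ measures in $\{|0\rangle,|1\rangle\}$; for $v\in V_P$ let $m_v$ be the number of neighbours of $v$ in $W\setminus V_P$ with outcome $|1\rangle$. Each $v\in V_P\setminus\{R\}$ applies $Z^{m_v}$. 3. For $l=2,\dots,L-2$ in turn, $v_l$ measures in $\{|\pm\rangle\}$. On outcome $+$, $j$ applies $(iY)^{-1/2}$ and $v_{l+1}$ applies $Z$; on outcome $-$, $j$ applies $(-iY)^{-1/2}$.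 Here $(\pm iY)^{1/2}=(I\pm iY)/\sqrt2$. 4. If $L\ge3$, then $v_{L-1}$ measures in $\{|\pm\rangle\}$, and $j$ applies $U_R^{T}Z^{m_R+1}H(iY)^{-1/2}$ on outcome $+$ and $U_R^{T}Z^{m_R}H(-iY)^{-1/2}$ on outcome $-$. If $L=2$, then $j$ applies $U_R^{T}Z^{m_R}H$. -/

import Mathlib

open Matrix Finset
open scoped ComplexOrder

/-! ## Qubits, Pauli and Clifford operators

A register of qubits labelled by `V` has the computational basis `V → Fin 2`.  Vectors are
functions `(V → Fin 2) → ℂ`, operators are complex matrices indexed by `V → Fin 2`. -/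

/-- A `2 × 2` complex matrix: an operator on one qubit. -/
abbrev QubitOp : Type := Matrix (Fin 2) (Fin 2) ℂ

def pauliX : QubitOp := !![0, 1; 1, 0]

def pauliY : QubitOp := !![0, -Complex.I; Complex.I, 0]

def pauliZ : QubitOp := !![1, 0; 0, -1]

/-- The three Pauli matrices. -/
def paulis : Set QubitOp := {pauliX, pauliY, pauliZ}

/-- The Hadamard gate. -/
noncomputable def hadamard : QubitOp := ((√2 : ℝ) : ℂ)⁻¹ • !![1, 1; 1, -1]

/-- One-qubit Clifford operators: unitaries mapping Pauli operators to Pauli operators (up to a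
sign) by conjugation. -/
def IsClifford (U : QubitOp) : Prop :=
  U ∈ Matrix.unitaryGroup (Fin 2) ℂ ∧
    ∀ σ ∈ paulis, ∃ τ ∈ paulis, U * σ * Uᴴ = τ ∨ U * σ * Uᴴ = -τ

/-- The operator `A` on the local system `Q` of `k`, tensored with the identity on the local
systems of all others. -/
def localOp {V Q : Type*} [Fintype V] [DecidableEq V] [DecidableEq Q] (k : V)
    (A : Matrix Q Q ℂ) : Matrix (V → Q) (V → Q) ℂ :=
  Matrix.of fun x y => if ∀ l, l ≠ k → x l = y l then A (x k) (y k) else 0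

/-- The tensor product of the one-qubit operators `U k`. -/
def tensorOp {V : Type*} [Fintype V] (U : V → QubitOp) :
    Matrix (V → Fin 2) (V → Fin 2) ℂ :=
  Matrix.of fun x y => ∏ k, U k (x k) (y k)

/-- The operator `|ψ⟩⟨ψ|`. -/
def ketBra {ι : Type*} (ψ : ι → ℂ) : Matrix ι ι ℂ := Matrix.vecMulVec ψ (star ψ)

/-- Density operators. -/
def IsDensity {ι : Type*} [Fintype ι] (ρ : Matrix ι ι ℂ) : Prop :=
  ρ.PosSemidef ∧ ρ.trace = 1

/-! ## Stabilizer codes -/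

/-- The Pauli group on the qubits labelled by `P`, generated by the Pauli operators on each
qubit (as these are involutions, the monoid they generate is a group). -/
def pauliGroup (P : Type*) [Fintype P] [DecidableEq P] :
    Submonoid (Matrix (P → Fin 2) (P → Fin 2) ℂ) :=
  Submonoid.closure {M | ∃ k : P, ∃ σ ∈ paulis, M = localOp k σ}

/-- A stabilizer: an abelian group of elements of the Pauli group. -/
def IsStabilizer {P : Type*} [Fintype P] [DecidableEq P]
    (S : Subgroup (Matrix (P → Fin 2) (P → Fin 2) ℂ)ˣ) : Prop :=
  (∀ s ∈ S, (s : Matrix (P → Fin 2) (P → Fin 2) ℂ) ∈ pauliGroup P) ∧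
    ∀ s ∈ S, ∀ t ∈ S, s * t = t * s

/-- The stabilizer code of `S`: all vectors fixed by every element of `S`. -/
def codeSpace {P : Type*} [Fintype P] [DecidableEq P]
    (S : Subgroup (Matrix (P → Fin 2) (P → Fin 2) ℂ)ˣ) : Submodule ℂ ((P → Fin 2) → ℂ) where
  carrier := {ψ | ∀ s ∈ S, (s : Matrix (P → Fin 2) (P → Fin 2) ℂ) *ᵥ ψ = ψ}
  add_mem' := fun ha hb s hs => by rw [Matrix.mulVec_add, ha s hs, hb s hs]
  zero_mem' := fun s _ => Matrix.mulVec_zero _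
  smul_mem' := fun c _ ha s hs => by rw [Matrix.mulVec_smul, ha s hs]

/-- `e 0, e 1` is an orthonormal basis (the logical basis) of the two-dimensional stabilizer
code of the stabilizer `S`. -/
def IsLogicalBasis {P : Type*} [Fintype P] [DecidableEq P]
    (S : Subgroup (Matrix (P → Fin 2) (P → Fin 2) ℂ)ˣ)
    (e : Fin 2 → (P → Fin 2) → ℂ) : Prop :=
  IsStabilizer S ∧ (∀ a b, star (e a) ⬝ᵥ e b = if a = b then 1 else 0) ∧
    Submodule.span ℂ (Set.range e) = codeSpace S

/-! ## The maximally entangled state and graph states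

The parties are the elements of `P`; the qubits of the state shared with the reference system
are labelled by `Option P`, where `none` is the reference `R` and `some k` is party `k`. -/

/-- `(|0⟩ ⊗ |e 0⟩ + |1⟩ ⊗ |e 1⟩) / √2`, the first factor being the reference qubit. -/
noncomputable def maxEntangled {P : Type*} (e : Fin 2 → (P → Fin 2) → ℂ) :
    (Option P → Fin 2) → ℂ :=
  fun x => ((√2 : ℝ) : ℂ)⁻¹ * e (x none) (fun k => x (some k))

open Classical in
/-- The graph state of `G`: the controlled-`Z` gates of all edges (each is diagonal, and
multiplies a basis vector by `-1` if both ends of the edge are in state `1`) applied to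
`|+⟩ ⊗ ⋯ ⊗ |+⟩`. -/
noncomputable def graphState {V : Type*} [Fintype V] (G : SimpleGraph V) : (V → Fin 2) → ℂ :=
  fun x => (∏ ε ∈ G.edgeFinset, if ∀ v ∈ ε, x v = 1 then (-1 : ℂ) else 1) *
    ∏ _v : V, ((√2 : ℝ) : ℂ)⁻¹

/-- The local unitaries `U k` are Clifford and transform the pure state `ψ` to the pure
state `φ`. -/
def LCTransforms {V : Type*} [Fintype V] [DecidableEq V] (U : V → QubitOp)
    (ψ φ : (V → Fin 2) → ℂ) : Prop :=
  (∀ k, IsClifford (U k)) ∧ tensorOp U * ketBra ψ * (tensorOp U)ᴴ = ketBra φ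

/-! ## LOCC protocols -/

/-- A finite LOCC protocol among the parties `P`, each holding a local system with basis `Q`.
In each step a party `k` performs a quantum instrument on its own local system and announces the
outcome `i`; everything that happens afterwards may depend on it.  The instrument is given by
one Kraus operator for each outcome; a coarser instrument arises when what happens
afterwards does not use all of the information in `i`. -/
inductive Protocol (P Q : Type*) where
  | done : Protocol P Q
  | step (k : P) (m : ℕ) (K : Fin m → Matrix Q Q ℂ) (next : Fin m → Protocol P Q) :
      Protocol P Q

/-- All steps are performed by parties in `C`, and every local instrument is trace
preserving. -/
def Protocol.IsLOCC {P Q : Type*} [Fintype Q] [DecidableEq Q] (C : Finset P) :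
    Protocol P Q → Prop
  | .done => True
  | .step k _ K next => k ∈ C ∧ ∑ i, (K i)ᴴ * K i = 1 ∧ ∀ i, (next i).IsLOCC C

/-- The completely positive map implemented by a protocol (summed over all outcomes). -/
def Protocol.run {P Q : Type*} [Fintype P] [DecidableEq P] [Fintype Q] [DecidableEq Q] :
    Protocol P Q → Matrix (P → Q) (P → Q) ℂ → Matrix (P → Q) (P → Q) ℂ
  | .done, ρ => ρ
  | .step k _ K next, ρ => ∑ i, (next i).run (localOp k (K i) * ρ * (localOp k (K i))ᴴ)

/-! ## LOCC extraction of quantum information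

Every party holds its qubit and a local ancilla of dimension `d + 1`. -/

/-- The local system of a party: the qubit and the ancilla. -/
abbrev LocalSys (d : ℕ) : Type := Fin 2 × Fin (d + 1)

/-- The state `∑ ρ a b |e a⟩⟨e b|` of the code that encodes the qubit state `ρ`. -/
def encode {P : Type*} (e : Fin 2 → (P → Fin 2) → ℂ) (ρ : QubitOp) :
    Matrix (P → Fin 2) (P → Fin 2) ℂ :=
  ∑ a, ∑ b, ρ a b • Matrix.vecMulVec (e a) (star (e b))

/-- `M` on the qubits, and every ancilla in its state `|0⟩`. -/
def withAncilla {P : Type*} [Fintype P] (d : ℕ) (M : Matrix (P → Fin 2) (P → Fin 2) ℂ) :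
    Matrix (P → LocalSys d) (P → LocalSys d) ℂ :=
  Matrix.of fun x y =>
    if (∀ k, (x k).2 = 0) ∧ ∀ k, (y k).2 = 0 then M (fun k => (x k).1) (fun k => (y k).1) else 0

/-- The partial trace over everything except for the qubit of party `j`. -/
def reducedTo {P : Type*} [Fintype P] [DecidableEq P] {d : ℕ} (j : P)
    (M : Matrix (P → LocalSys d) (P → LocalSys d) ℂ) : QubitOp :=
  Matrix.of fun a b => ∑ x : P → LocalSys d,
    if (x j).1 = a then M x (Function.update x j (b, (x j).2)) else 0

/-- The protocol `Λ`, performed by the cooperating parties `C` only, extracts the quantum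
information encoded in the basis `e` to party `j`, whatever local operations `Γ` (even coordinated
by classical communication) the parties outside `C` perform. -/
def Extracts {P : Type*} [Fintype P] [DecidableEq P] (e : Fin 2 → (P → Fin 2) → ℂ) (j : P)
    (C : Finset P) {d : ℕ} (Λ : Protocol P (LocalSys d)) : Prop :=
  Λ.IsLOCC C ∧ ∀ Γ : Protocol P (LocalSys d), Γ.IsLOCC Cᶜ →
    ∀ ρ : QubitOp, IsDensity ρ →
      reducedTo j (Λ.run (Γ.run (withAncilla d (encode e ρ)))) = ρ

/-- Cooperation of the parties in `C` suffices for LOCC extraction to party `j`. -/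
def CanExtract {P : Type*} [Fintype P] [DecidableEq P] (e : Fin 2 → (P → Fin 2) → ℂ) (j : P)
    (C : Finset P) : Prop :=
  ∃ (d : ℕ) (Λ : Protocol P (LocalSys d)), Extracts e j C Λ

/-! ## The vertices near a path, and the extraction algorithm -/

open Classical in
/-- The vertices adjacent to some vertex of the path `p`. -/
noncomputable def pathNbhd {V : Type*} [Fintype V] {G : SimpleGraph V} {u v : V}
    (p : G.Walk u v) : Finset V :=
  univ.filter fun k => ∃ l ∈ p.support, G.Adj k l

namespace ExtractionAlgorithm

/-- Party `k` applies the gate `A` to its qubit. -/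
def gate {P : Type*} {d : ℕ} (k : P) (A : QubitOp) (next : Protocol P (LocalSys d)) :
    Protocol P (LocalSys d) :=
  .step k 1 (fun _ => Matrix.kronecker A 1) fun _ => next

/-- Party `k` measures its qubit in the basis `|0⟩, |1⟩`. -/
def measureZ {P : Type*} {d : ℕ} (k : P) (next : Fin 2 → Protocol P (LocalSys d)) :
    Protocol P (LocalSys d) :=
  .step k 2 (fun i => Matrix.kronecker (![!![1, 0; 0, 0], !![0, 0; 0, 1]] i : QubitOp) 1) next

/-- Party `k` measures its qubit in the basis `|+⟩` (outcome `0`), `|-⟩` (outcome `1`). -/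
noncomputable def measureX {P : Type*} {d : ℕ} (k : P)
    (next : Fin 2 → Protocol P (LocalSys d)) : Protocol P (LocalSys d) :=
  .step k 2
    (fun i => Matrix.kronecker
      ((2 : ℂ)⁻¹ • ![!![1, 1; 1, 1], !![1, -1; -1, 1]] i : QubitOp) 1) next

/-- Each party `k` of the list applies the gate `A k`. -/
def gates {P : Type*} {d : ℕ} (A : P → QubitOp) (L : List P)
    (next : Protocol P (LocalSys d)) : Protocol P (LocalSys d) :=
  L.foldr (fun k rest => gate k (A k) rest) next

/-- The parties of the list measure in the basis `|0⟩, |1⟩`; what follows depends on the record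
`s` of all outcomes. -/
def measureAllZ {P : Type*} [DecidableEq P] {d : ℕ} :
    List P → (P → Fin 2) → ((P → Fin 2) → Protocol P (LocalSys d)) → Protocol P (LocalSys d)
  | [], s, next => next s
  | v :: L, s, next => measureZ v fun i => measureAllZ L (Function.update s v i) next

/-- The gate `(iY)^(-1/2) = ((1 + iY)/√2)⁻¹`. -/
noncomputable def rootPlus : QubitOp := ((√2 : ℝ) : ℂ)⁻¹ • (1 - Complex.I • pauliY)

/-- The gate `(-iY)^(-1/2) = ((1 - iY)/√2)⁻¹`. -/
noncomputable def rootMinus : QubitOp := ((√2 : ℝ) : ℂ)⁻¹ • (1 + Complex.I • pauliY)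

/-- The part of the algorithm on the path.  The list holds the parties strictly between `j` and
`R` on the path that are still to be measured, starting next to `j`; `UR` is the Clifford
operator at the reference, and `m` the number of outcomes `1` at its neighbours off the path.
The first clause is only reached if `j` and `R` are adjacent. -/
noncomputable def alongPath {P : Type*} {d : ℕ} (j : P) (UR : QubitOp) (m : ℕ) :
    List P → Protocol P (LocalSys d)
  | [] => gate j (URᵀ * pauliZ ^ m * hadamard) .done
  | [v] => measureX v ![
      gate j (URᵀ * pauliZ ^ (m + 1) * hadamard * rootPlus) .done,
      gate j (URᵀ * pauliZ ^ m * hadamard * rootMinus) .done]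
  | v :: w :: L => measureX v ![
      gate j rootPlus (gate w pauliZ (alongPath j UR m (w :: L))),
      gate j rootMinus (alongPath j UR m (w :: L))]

open Classical in
/-- The neighbours off the path `p` of the vertex `v` whose recorded outcome is `1`, counted. -/
noncomputable def outcomeCount {P : Type*} [Fintype P] {G : SimpleGraph (Option P)}
    {u w : Option P} (p : G.Walk u w) (s : P → Fin 2) (v : Option P) : ℕ :=
  (univ.filter fun k : P => some k ∉ p.support ∧ G.Adj (some k) v ∧ s k = 1).card

open Classical in
/-- The extraction algorithm for the graph `G`, the local Clifford operators `U` and the path `p`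
from `j` to the reference: the parties on the path or next to it apply their Clifford operators;
those next to it but not on it measure in `|0⟩, |1⟩`; the parties `v` on the path
correct by powers of `Z`; then the parties strictly between `j` and the reference measure in
`|+⟩, |-⟩` one after the other, and corrections are applied. -/
noncomputable def protocol {P : Type*} [Fintype P] {G : SimpleGraph (Option P)}
    (U : Option P → QubitOp) {j : P} (p : G.Walk (some j) none) (d : ℕ) :
    Protocol P (LocalSys d) :=
  gates (fun k => U (some k)) (eraseNone (pathNbhd p)).toList <|
    measureAllZ ((eraseNone (pathNbhd p)).filter fun k => some k ∉ p.support).toList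
      (fun _ => 0) fun s =>
        gates (fun k => pauliZ ^ outcomeCount p s (some k)) p.support.reduceOption <|
          alongPath j (U none) (outcomeCount p s none) p.support.reduceOption.tail

end ExtractionAlgorithm

/-! ## Local operators acting on vectors -/

section LocalOperators

variable {V Q : Type*} [Fintype V] [DecidableEq V] [DecidableEq Q]

/-! A protocol is followed on both logical basis vectors at once: each record of outcomes sends the
pair `e 0, e 1` to a pair `ψ 0, ψ 1`, and the output on input `ρ` is the sum over records of `∑ ρ a
b |ψ a⟩⟨ψ b|` (`Protocol.run_mixture_mem`). Applying every party's Clifford gate and inverting `U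
none` at the reference turns the pair, up to a constant, into `y ↦ ∑ r, star (U none r a) *
graphSign G (withRef r y)` (`exists_tensorOp_mulVec_eq`). The rest is bookkeeping of edge signs.

Upper bound. In a forest the sign splits into the edges of the path, the edges leaving it, and the
edges off it (`graphSign_eq_mul_of_isPath`). Measuring the off-path neighbours in the `Z` basis
turns the second factor into powers of `Z`, which are corrected, so a chain from `j` to the
reference remains. Each `X` measurement shortens the chain, `j` taking the place of the measured
party, and the last gate undoes the final edge and the reference operator (`allLeaves_alongPath`).
Every leaf is then `|a⟩` at `j` times a vector independent of `a`, so the reduction is `c • ρ`, and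
preservation of the trace gives `c = 1`. Operations of parties outside `C` commute with the protocol
and keep this form, so adversarial actions, and even the missing Clifford gates of these parties,
are harmless.

Lower bound. If the outsiders can bring the pair to the form `α a ⊗ β` with `j` on the side of `β`,
no coherence can reach `j` (`not_extracts_of_allLeaves`). A path party outside `C` achieves this by
a `Z` measurement, which cuts the tree. An off-path neighbour `w` of a path vertex `v` achieves it
together with its own off-path neighbours: they measure `Z` and `w` measures `X`, which fixes the
`Z` value of `v`. So `C` contains all path parties and meets the star formed by each such `w` and
its off-path neighbours. Acyclicity makes these stars disjoint, which yields an injection into `C`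
(`CanExtract.card_le`). -/

theorem localOp_conjTranspose (k : V) (A : Matrix Q Q ℂ) :
    (localOp k A)ᴴ = localOp k Aᴴ := by
  ext x y
  simp only [localOp, Matrix.conjTranspose_apply, Matrix.of_apply]
  have : (∀ l, l ≠ k → y l = x l) ↔ ∀ l, l ≠ k → x l = y l :=
    forall₂_congr fun l _ => eq_comm
  simp only [this]
  split_ifs <;> simp

theorem localOp_sum {m : ℕ} (k : V) (A : Fin m → Matrix Q Q ℂ) :
    localOp k (∑ i, A i) = ∑ i, localOp k (A i) := by
  ext x y
  simp only [localOp, Matrix.of_apply, Matrix.sum_apply]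
  split_ifs <;> simp

variable [Fintype Q]

theorem localOp_mulVec (k : V) (A : Matrix Q Q ℂ) (ψ : (V → Q) → ℂ) (x : V → Q) :
    (localOp k A *ᵥ ψ) x = ∑ i, A (x k) i * ψ (Function.update x k i) := by
  simp only [Matrix.mulVec, dotProduct, localOp, Matrix.of_apply]
  symm
  refine Finset.sum_of_injOn (fun i => Function.update x k i) ?_ (by simp) ?_ ?_
  · intro a _ b _ h
    simpa using congrFun h k
  · intro y _ hy
    rw [if_neg, zero_mul]
    intro h
    refine hy ⟨y k, by simp, ?_⟩
    funext l
    by_cases hl : l = k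
    · subst hl; simp
    · simp [hl, h l hl]
  · intro i _
    rw [if_pos]
    · simp
    · intro l hl; simp [hl]

theorem localOp_mulVec_comm {k l : V} (h : k ≠ l) (A B : Matrix Q Q ℂ) (ψ : (V → Q) → ℂ) :
    localOp k A *ᵥ (localOp l B *ᵥ ψ) = localOp l B *ᵥ (localOp k A *ᵥ ψ) := by
  funext x
  simp only [localOp_mulVec, Finset.mul_sum]
  rw [Finset.sum_comm]
  refine Finset.sum_congr rfl fun i _ => Finset.sum_congr rfl fun m _ => ?_
  rw [Function.update_comm h, Function.update_of_ne h.symm, Function.update_of_ne h]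
  ring

theorem localOp_mulVec_mulVec (k : V) (A B : Matrix Q Q ℂ) (ψ : (V → Q) → ℂ) :
    localOp k A *ᵥ (localOp k B *ᵥ ψ) = localOp k (A * B) *ᵥ ψ := by
  funext x
  simp only [localOp_mulVec, Finset.mul_sum, Function.update_self, Function.update_idem,
    Matrix.mul_apply, Finset.sum_mul]
  rw [Finset.sum_comm]
  refine Finset.sum_congr rfl fun i _ => Finset.sum_congr rfl fun m _ => ?_
  ring

theorem localOp_one_mulVec (k : V) (ψ : (V → Q) → ℂ) :
    localOp k (1 : Matrix Q Q ℂ) *ᵥ ψ = ψ := by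
  funext x
  simp [localOp_mulVec, Matrix.one_apply]

theorem localOp_one (k : V) : localOp k (1 : Matrix Q Q ℂ) = 1 :=
  Matrix.mulVec_injective (funext fun ψ => by rw [localOp_one_mulVec, Matrix.one_mulVec])

theorem localOp_mul (k : V) (A B : Matrix Q Q ℂ) :
    localOp k A * localOp k B = localOp k (A * B) :=
  Matrix.mulVec_injective (funext fun ψ => by
    rw [← Matrix.mulVec_mulVec, localOp_mulVec_mulVec])

end LocalOperators

/-! ### Tensor products and lists of one-qubit gates -/

section TensorOperators

variable {V : Type*} [Fintype V] [DecidableEq V]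

theorem localOp_mulVec_tensorOp (k : V) (A : QubitOp) (B : V → QubitOp)
    (ψ : (V → Fin 2) → ℂ) :
    localOp k A *ᵥ (tensorOp B *ᵥ ψ) = tensorOp (Function.update B k (A * B k)) *ᵥ ψ := by
  funext x
  rw [localOp_mulVec]
  simp only [Matrix.mulVec, dotProduct, tensorOp, Matrix.of_apply, Finset.mul_sum]
  rw [Finset.sum_comm]
  refine Finset.sum_congr rfl fun y _ => ?_
  have h : ∀ (C : V → QubitOp) (z : V → Fin 2),
      ∏ l, C l (z l) (y l) = C k (z k) (y k) * ∏ l ∈ univ.erase k, C l (z l) (y l) :=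
    fun C z => (Finset.mul_prod_erase _ _ (mem_univ k)).symm
  simp only [h, Function.update_self, Matrix.mul_apply, Finset.sum_mul]
  refine Finset.sum_congr rfl fun i _ => ?_
  have h' : ∏ l ∈ univ.erase k, B l (Function.update x k i l) (y l) =
      ∏ l ∈ univ.erase k, (Function.update B k (A * B k)) l (x l) (y l) := by
    refine Finset.prod_congr rfl fun l hl => ?_
    rw [Function.update_of_ne (Finset.ne_of_mem_erase hl),
      Function.update_of_ne (Finset.ne_of_mem_erase hl)]
  rw [h']
  ring

theorem tensorOp_one_mulVec (ψ : (V → Fin 2) → ℂ) :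
    tensorOp (fun _ => (1 : QubitOp)) *ᵥ ψ = ψ := by
  have : tensorOp (fun _ : V => (1 : QubitOp)) = 1 := by
    ext x y
    simp only [tensorOp, Matrix.of_apply, Matrix.one_apply]
    rw [Finset.prod_ite_zero]
    simp [funext_iff]
  rw [this, Matrix.one_mulVec]

/-- The gates `A k` at the vertices of the list applied one after the other. -/
def applyGates {V : Type*} [Fintype V] [DecidableEq V] (A : V → QubitOp) (L : List V)
    (ψ : (V → Fin 2) → ℂ) : (V → Fin 2) → ℂ :=
  L.foldl (fun φ k => localOp k (A k) *ᵥ φ) ψ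

theorem applyGates_tensorOp (A : V → QubitOp) (L : List V) (hL : L.Nodup) (B : V → QubitOp)
    (ψ : (V → Fin 2) → ℂ) :
    applyGates A L (tensorOp B *ᵥ ψ) =
      tensorOp (fun k => if k ∈ L then A k * B k else B k) *ᵥ ψ := by
  induction L generalizing B with
  | nil => simp [applyGates]
  | cons v L ih =>
    rw [List.nodup_cons] at hL
    have : applyGates A (v :: L) (tensorOp B *ᵥ ψ) =
        applyGates A L (localOp v (A v) *ᵥ (tensorOp B *ᵥ ψ)) := rfl
    rw [this, localOp_mulVec_tensorOp, ih hL.2]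
    congr 2
    funext k
    by_cases hk : k = v
    · subst hk; simp [hL.1]
    · simp [hk]

/-- Used with `L` the parties outside a coalition and `M` those inside: together their gates make up
the full tensor product. -/
theorem applyGates_append_eq_tensorOp (A : V → QubitOp) (L M : List V)
    (hLM : (L ++ M).Nodup) (hmem : ∀ k, k ∈ L ++ M) (ψ : (V → Fin 2) → ℂ) :
    applyGates A M (applyGates A L ψ) = tensorOp A *ᵥ ψ := by
  have h : applyGates A M (applyGates A L ψ) = applyGates A (L ++ M) ψ := by
    simp [applyGates, List.foldl_append]
  rw [h, ← tensorOp_one_mulVec ψ, applyGates_tensorOp A _ hLM, tensorOp_one_mulVec]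
  simp only [hmem, if_true, mul_one]

end TensorOperators

/-! ## Protocols acting on families of vectors -/

theorem DependsOn.update_eq {P Q R : Type*} [DecidableEq P] {f : (P → Q) → R} {A : Set P} (hf : DependsOn f A)
    {k : P} (hk : k ∉ A) (x : P → Q) (i : Q) : f (Function.update x k i) = f x :=
  hf fun l hl => Function.update_of_ne (by rintro rfl; exact hk hl) _ _

section Mixtures

variable {P Q : Type*} [Fintype P] [DecidableEq P] [Fintype Q] [DecidableEq Q]

/-- Every family of vectors obtained from `ψ` by running the protocol, one for each sequence of
measurement outcomes, satisfies `T`. -/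
def Protocol.AllLeaves (T : (Fin 2 → (P → Q) → ℂ) → Prop) :
    Protocol P Q → (Fin 2 → (P → Q) → ℂ) → Prop
  | .done, ψ => T ψ
  | .step k _ K next, ψ => ∀ i, (next i).AllLeaves T fun a => localOp k (K i) *ᵥ ψ a

/-- The operator `∑ ρ a b |ψ a⟩⟨ψ b|`. -/
def mixture {ι : Type*} (ρ : QubitOp) (ψ : Fin 2 → ι → ℂ) : Matrix ι ι ℂ :=
  ∑ a, ∑ b, ρ a b • Matrix.vecMulVec (ψ a) (star (ψ b))

theorem mixture_apply {ι : Type*} (ρ : QubitOp) (ψ : Fin 2 → ι → ℂ) (x y : ι) :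
    mixture ρ ψ x y = ∑ a, ∑ b, ρ a b * (ψ a x * star (ψ b y)) := by
  simp [mixture, Matrix.sum_apply, Matrix.vecMulVec_apply]

theorem mul_mixture_mul_conjTranspose {ι : Type*} [Fintype ι] (M : Matrix ι ι ℂ) (ρ : QubitOp)
    (ψ : Fin 2 → ι → ℂ) : M * mixture ρ ψ * Mᴴ = mixture ρ fun a => M *ᵥ ψ a := by
  simp only [mixture, Matrix.mul_sum, Matrix.sum_mul, Matrix.mul_smul, Matrix.smul_mul,
    Matrix.mul_vecMulVec, Matrix.vecMulVec_mul, Matrix.star_mulVec]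

theorem Protocol.run_zero (Λ : Protocol P Q) : Λ.run 0 = 0 := by
  induction Λ with
  | done => rfl
  | step k m K next ih => simp [Protocol.run, ih]

theorem Protocol.run_add (Λ : Protocol P Q) (M N : Matrix (P → Q) (P → Q) ℂ) :
    Λ.run (M + N) = Λ.run M + Λ.run N := by
  induction Λ generalizing M N with
  | done => rfl
  | step k m K next ih =>
    simp [Protocol.run, mul_add, add_mul, ih, Finset.sum_add_distrib]

theorem Protocol.trace_run {C : Finset P} (Λ : Protocol P Q) (hΛ : Λ.IsLOCC C)
    (M : Matrix (P → Q) (P → Q) ℂ) : (Λ.run M).trace = M.trace := by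
  induction Λ generalizing M with
  | done => rfl
  | step k m K next ih =>
    obtain ⟨-, hK, hn⟩ := hΛ
    simp only [Protocol.run, Matrix.trace_sum, ih _ (hn _)]
    have h : ∀ i, (localOp k (K i) * M * (localOp k (K i))ᴴ).trace =
        (localOp k ((K i)ᴴ * K i) * M).trace := fun i => by
      rw [Matrix.trace_mul_comm, ← Matrix.mul_assoc, localOp_conjTranspose, localOp_mul]
    simp only [h, ← Matrix.trace_sum, ← Matrix.sum_mul, ← localOp_sum, hK, localOp_one, one_mul]

/-- The finite sums of maps `ρ ↦ ∑ ρ a b |ψ a⟩⟨ψ b|` for families `ψ` satisfying `T`. -/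
def mixtures {ι : Type*} (T : (Fin 2 → ι → ℂ) → Prop) : AddSubmonoid (QubitOp → Matrix ι ι ℂ) :=
  AddSubmonoid.closure {N | ∃ ψ, T ψ ∧ N = fun ρ => mixture ρ ψ}

/-- Conjugating a mixture by a Kraus operator gives the mixture of the transformed pair, so the
output is a sum over the leaves with the same coefficients `ρ a b`. -/
theorem Protocol.run_mixture_mem {T : (Fin 2 → (P → Q) → ℂ) → Prop} (Λ : Protocol P Q)
    (ψ : Fin 2 → (P → Q) → ℂ) (h : Λ.AllLeaves T ψ) :
    (fun ρ => Λ.run (mixture ρ ψ)) ∈ mixtures T := by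
  induction Λ generalizing ψ with
  | done => exact AddSubmonoid.subset_closure ⟨ψ, h, rfl⟩
  | step k m K next ih =>
    have := sum_mem (S := mixtures T) (t := univ) fun i _ => ih i _ (h i)
    convert this using 1
    funext ρ
    simp only [Protocol.run, mul_mixture_mul_conjTranspose, Finset.sum_apply]

/-- Sequential composition: `Λ` acts on a sum of mixtures left behind by an earlier protocol. -/
theorem Protocol.run_mem_mixtures {T T' : (Fin 2 → (P → Q) → ℂ) → Prop} (Λ : Protocol P Q)
    (h : ∀ ψ, T ψ → Λ.AllLeaves T' ψ) {N : QubitOp → Matrix (P → Q) (P → Q) ℂ}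
    (hN : N ∈ mixtures T) : (fun ρ => Λ.run (N ρ)) ∈ mixtures T' := by
  induction hN using AddSubmonoid.closure_induction with
  | mem N hN =>
    obtain ⟨ψ, hψ, rfl⟩ := hN
    exact Λ.run_mixture_mem ψ (h ψ hψ)
  | zero =>
    convert zero_mem (mixtures T') using 1
    funext ρ
    simp [Protocol.run_zero]
  | add N N' _ _ ih ih' =>
    convert add_mem ih ih' using 1
    funext ρ
    simp [Protocol.run_add]

theorem Protocol.AllLeaves.mono {T T' : (Fin 2 → (P → Q) → ℂ) → Prop}
    (h : ∀ ψ, T ψ → T' ψ) (Λ : Protocol P Q) (ψ : Fin 2 → (P → Q) → ℂ)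
    (hψ : Λ.AllLeaves T ψ) : Λ.AllLeaves T' ψ := by
  induction Λ generalizing ψ with
  | done => exact h _ hψ
  | step k m K next ih => exact fun i => ih i _ (hψ i)

/-- A property of families that is stable under the local operators of the parties in `C` holds
after every protocol of these parties. -/
theorem Protocol.IsLOCC.allLeaves {T : (Fin 2 → (P → Q) → ℂ) → Prop} {C : Finset P}
    (hT : ∀ k ∈ C, ∀ A ψ, T ψ → T fun a => localOp k A *ᵥ ψ a)
    (Λ : Protocol P Q) (hΛ : Λ.IsLOCC C) (ψ : Fin 2 → (P → Q) → ℂ) (hψ : T ψ) :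
    Λ.AllLeaves T ψ := by
  induction Λ generalizing ψ with
  | done => exact hψ
  | step k m K next ih => exact fun i => ih i (hΛ.2.2 i) _ (hT k hΛ.1 _ _ hψ)

/-- Local operators of other parties commute with a protocol. -/
theorem Protocol.allLeaves_localOp_iff {T : (Fin 2 → (P → Q) → ℂ) → Prop} {C : Finset P} {k : P}
    (hk : k ∉ C) (A : Matrix Q Q ℂ) (Λ : Protocol P Q) (hΛ : Λ.IsLOCC C)
    (ψ : Fin 2 → (P → Q) → ℂ) :
    (Λ.AllLeaves T fun a => localOp k A *ᵥ ψ a) ↔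
      Λ.AllLeaves (fun φ => T fun a => localOp k A *ᵥ φ a) ψ := by
  induction Λ generalizing ψ with
  | done => rfl
  | step l m K next ih =>
    refine forall_congr' fun i => ?_
    have hkl : l ≠ k := fun h => hk (h ▸ hΛ.1)
    simp only [localOp_mulVec_comm hkl]
    exact ih i (hΛ.2.2 i) _

/-- A property of families that is stable under the local operators of party `k` may be verified
after party `k`, not acting in the protocol, has applied an invertible operator. -/
theorem Protocol.allLeaves_of_localOp {T : (Fin 2 → (P → Q) → ℂ) → Prop} {C : Finset P} {k : P}
    (hk : k ∉ C) (hT : ∀ A ψ, T ψ → T fun a => localOp k A *ᵥ ψ a) {A B : Matrix Q Q ℂ}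
    (hBA : B * A = 1) (Λ : Protocol P Q) (hΛ : Λ.IsLOCC C) (ψ : Fin 2 → (P → Q) → ℂ)
    (h : Λ.AllLeaves T fun a => localOp k A *ᵥ ψ a) : Λ.AllLeaves T ψ := by
  rw [Λ.allLeaves_localOp_iff hk A hΛ] at h
  refine Protocol.AllLeaves.mono (fun φ hφ => ?_) Λ ψ h
  simpa only [localOp_mulVec_mulVec, hBA, localOp_one_mulVec] using hT B _ hφ

/-! ### Product families -/

/-- The vectors `ψ a` are tensor products of a vector on `A` and a fixed vector on the complement
of `A`. -/
def IsProductFamily (A : Set P) (ψ : Fin 2 → (P → Q) → ℂ) : Prop :=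
  ∃ (α : Fin 2 → (P → Q) → ℂ) (β : (P → Q) → ℂ),
    (∀ a, DependsOn (α a) A) ∧ DependsOn β Aᶜ ∧ ∀ a x, ψ a x = α a x * β x

theorem DependsOn.localOp_mulVec {f : (P → Q) → ℂ} {A : Set P} (hf : DependsOn f A)
    (k : P) (hk : k ∈ A) (B : Matrix Q Q ℂ) : DependsOn (localOp k B *ᵥ f) A := by
  intro x y h
  rw [_root_.localOp_mulVec, _root_.localOp_mulVec, h k hk]
  refine Finset.sum_congr rfl fun i _ => ?_
  congr 1
  apply hf
  intro l hl
  by_cases hlk : l = k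
  · subst hlk; simp
  · simp [hlk, h l hl]

/-- A local operator acts on only one of the two factors, whichever side `k` lies on; hence LOCC
cannot undo the product form. -/
theorem IsProductFamily.localOp {A : Set P} {ψ : Fin 2 → (P → Q) → ℂ}
    (h : IsProductFamily A ψ) (k : P) (B : Matrix Q Q ℂ) :
    IsProductFamily A fun a => localOp k B *ᵥ ψ a := by
  obtain ⟨α, β, hα, hβ, h⟩ := h
  by_cases hk : k ∈ A
  · refine ⟨fun a => _root_.localOp k B *ᵥ α a, β, fun a => (hα a).localOp_mulVec k hk B, hβ,
      fun a x => ?_⟩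
    simp only [_root_.localOp_mulVec, h, Finset.sum_mul, hβ.update_eq (not_not_intro hk), mul_assoc]
  · refine ⟨α, _root_.localOp k B *ᵥ β, hα, hβ.localOp_mulVec k hk B, fun a x => ?_⟩
    simp only [_root_.localOp_mulVec, h, Finset.mul_sum, (hα _).update_eq hk]
    exact Finset.sum_congr rfl fun i _ => by ring

end Mixtures

/-- A vector on the qubits, all ancillas being in the state `|0⟩`. -/
def liftVec {P : Type*} [Fintype P] (d : ℕ) (ψ : (P → Fin 2) → ℂ) : (P → LocalSys d) → ℂ :=
  fun x => if ∀ k, (x k).2 = 0 then ψ fun k => (x k).1 else 0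

theorem withAncilla_encode {P : Type*} [Fintype P] {d : ℕ} (e : Fin 2 → (P → Fin 2) → ℂ) (ρ : QubitOp) :
    withAncilla d (encode e ρ) = mixture ρ fun a => liftVec d (e a) := by
  ext x y
  rw [mixture_apply]
  have : encode e ρ = mixture ρ e := rfl
  simp only [withAncilla, Matrix.of_apply, this, mixture_apply, liftVec]
  by_cases hx : ∀ k, (x k).2 = 0 <;> by_cases hy : ∀ k, (y k).2 = 0 <;> simp [hx, hy]

/-! ### Criteria for and against extraction -/

section Extraction

variable {P : Type*} [Fintype P] [DecidableEq P] {d : ℕ}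

theorem trace_reducedTo (j : P) (M : Matrix (P → LocalSys d) (P → LocalSys d) ℂ) :
    (reducedTo j M).trace = M.trace := by
  simp only [Matrix.trace, Matrix.diag_apply, reducedTo, Matrix.of_apply]
  rw [Finset.sum_comm]
  refine Finset.sum_congr rfl fun x _ => ?_
  rw [Finset.sum_ite_eq]
  simp

theorem reducedTo_add (j : P) (M N : Matrix (P → LocalSys d) (P → LocalSys d) ℂ) :
    reducedTo j (M + N) = reducedTo j M + reducedTo j N := by
  ext a b
  simp only [reducedTo, Matrix.of_apply, Matrix.add_apply, ← Finset.sum_add_distrib]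
  exact Finset.sum_congr rfl fun x _ => by split_ifs <;> simp

theorem reducedTo_zero (j : P) :
    reducedTo j (0 : Matrix (P → LocalSys d) (P → LocalSys d) ℂ) = 0 := by
  ext a b
  simp [reducedTo]

/-- The vector `ψ a` is `|a⟩` at the qubit of `j`, tensored with a vector that is the same
for `a = 0` and `a = 1`. -/
def IsDecoded (j : P) (ψ : Fin 2 → (P → LocalSys d) → ℂ) : Prop :=
  ∃ η : (P → LocalSys d) → ℂ, (∀ x b, η (Function.update x j (b, (x j).2)) = η x) ∧
    ∀ a x, ψ a x = if (x j).1 = a then η x else 0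

theorem IsDecoded.localOp {j k : P} (hk : k ≠ j) (A : Matrix (LocalSys d) (LocalSys d) ℂ)
    {ψ : Fin 2 → (P → LocalSys d) → ℂ} (h : IsDecoded j ψ) :
    IsDecoded j fun a => localOp k A *ᵥ ψ a := by
  obtain ⟨η, hη, h⟩ := h
  refine ⟨_root_.localOp k A *ᵥ η, fun x b => ?_, fun a x => ?_⟩
  · simp only [localOp_mulVec, Function.update_of_ne hk]
    refine Finset.sum_congr rfl fun i _ => ?_
    have := hη (Function.update x k i) b
    rw [Function.update_of_ne hk.symm] at this
    rw [Function.update_comm hk.symm, this]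
  · simp only [localOp_mulVec, h, Function.update_of_ne hk.symm]
    split_ifs <;> simp

/-- The entry `a, b` of the reduction is `ρ a b` times the squared norm of `η` on the slice where
`j` has value `a`; this norm is the same for both slices because `η` ignores the qubit of `j`. -/
theorem IsDecoded.reducedTo_mixture {j : P} {ψ : Fin 2 → (P → LocalSys d) → ℂ}
    (h : IsDecoded j ψ) : ∃ c : ℂ, ∀ ρ, reducedTo j (mixture ρ ψ) = c • ρ := by
  obtain ⟨η, hη, h⟩ := h
  have hsum : ∀ a, (∑ x : P → LocalSys d, if (x j).1 = a then η x * star (η x) else 0) =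
      ∑ x : P → LocalSys d, if (x j).1 = 0 then η x * star (η x) else 0 := by
    intro a
    -- Exchanging the values `a` and `0` at the qubit of `j` maps one slice onto the other.
    let ε : (P → LocalSys d) ≃ (P → LocalSys d) := Equiv.piCongrRight fun k =>
      if k = j then (Equiv.swap a 0).prodCongr (Equiv.refl _) else Equiv.refl _
    rw [← Equiv.sum_comp ε]
    have hε : ∀ x, ε x = Function.update x j (Equiv.swap a 0 (x j).1, (x j).2) := by
      intro x
      funext k
      by_cases hk : k = j
      · subst hk; simp [ε, Prod.map]
      · simp [ε, hk]
    refine Finset.sum_congr rfl fun x _ => ?_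
    rw [hε, hη, Function.update_self]
    have : (Equiv.swap a 0) (x j).1 = a ↔ (x j).1 = 0 := by
      rw [Equiv.swap_apply_eq_iff, Equiv.swap_apply_left]
    simp only [this]
  refine ⟨∑ x : P → LocalSys d, if (x j).1 = 0 then η x * star (η x) else 0, fun ρ => ?_⟩
  · ext a b
    rw [Matrix.smul_apply, ← hsum a, smul_eq_mul, Finset.sum_mul]
    simp only [reducedTo, Matrix.of_apply]
    refine Finset.sum_congr rfl fun x _ => ?_
    by_cases hx : (x j).1 = a
    · simp only [hx, if_true, mixture_apply, h, Function.update_self, hη]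
      rw [Finset.sum_eq_single a _ (by simp), Finset.sum_eq_single b _ (by simp)]
      · simp only [if_true]; ring
      · intro b' _ hb; simp [hb.symm]
      · intro a' _ ha; simp [ha.symm]
    · simp [hx]

theorem exists_reducedTo_eq_smul {j : P}
    {N : QubitOp → Matrix (P → LocalSys d) (P → LocalSys d) ℂ}
    (hN : N ∈ mixtures (IsDecoded (d := d) j)) : ∃ c : ℂ, ∀ ρ, reducedTo j (N ρ) = c • ρ := by
  induction hN using AddSubmonoid.closure_induction with
  | mem N hN =>
    obtain ⟨ψ, hψ, rfl⟩ := hN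
    exact hψ.reducedTo_mixture
  | zero => exact ⟨0, fun ρ => by simp [reducedTo_zero]⟩
  | add N N' _ _ ih ih' =>
    obtain ⟨c, hc⟩ := ih
    obtain ⟨c', hc'⟩ := ih'
    exact ⟨c + c', fun ρ => by simp [reducedTo_add, hc, hc', add_smul]⟩

/-- The state `|+⟩⟨+|` of a qubit. -/
noncomputable def plusState : QubitOp := !![2⁻¹, 2⁻¹; 2⁻¹, 2⁻¹]

/-- Product families do not transmit coherence: if the computational basis states are reproduced
then no off-diagonal element is. -/
theorem reducedTo_plusState_eq_zero {j : P} {A : Set P} (hj : j ∉ A)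
    {N : QubitOp → Matrix (P → LocalSys d) (P → LocalSys d) ℂ}
    (hN : N ∈ mixtures (IsProductFamily (Q := LocalSys d) A)) :
    0 ≤ reducedTo j (N (Matrix.single 0 0 1)) 1 1 ∧ 0 ≤ reducedTo j (N (Matrix.single 1 1 1)) 0 0 ∧
      (reducedTo j (N (Matrix.single 0 0 1)) 1 1 = 0 →
        reducedTo j (N (Matrix.single 1 1 1)) 0 0 = 0 → reducedTo j (N plusState) 0 1 = 0) := by
  induction hN using AddSubmonoid.closure_induction with
  | mem N hN =>
    obtain ⟨ψ, ⟨α, β, hα, hβ, h⟩, rfl⟩ := hN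
    have hdiag : ∀ a b, reducedTo j (mixture (Matrix.single a a 1) ψ) b b =
        ∑ x : P → LocalSys d, if (x j).1 = b then ψ a x * star (ψ a x) else 0 := by
      intro a b
      simp only [reducedTo, Matrix.of_apply]
      refine Finset.sum_congr rfl fun x _ => ?_
      split_ifs with hx
      · have : (b, (x j).2) = x j := by rw [← hx]
        rw [this, Function.update_eq_self, mixture_apply]
        simp [Matrix.single_apply, ite_and]
      · rfl
    have hnonneg : ∀ a b x, 0 ≤ if ((x : P → LocalSys d) j).1 = b then ψ a x * star (ψ a x)
        else 0 := by
      intro a b x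
      split_ifs
      · exact mul_star_self_nonneg _
      · exact le_rfl
    have hzero : ∀ a b, reducedTo j (mixture (Matrix.single a a 1) ψ) b b = 0 →
        ∀ x : P → LocalSys d, (x j).1 = b → ψ a x = 0 := by
      intro a b h0 x hx
      rw [hdiag, Finset.sum_eq_zero_iff_of_nonneg fun x _ => hnonneg a b x] at h0
      have := h0 x (mem_univ x)
      rw [if_pos hx] at this
      simpa using this
    refine ⟨?_, ?_, fun h0 h1 => ?_⟩
    · rw [hdiag]; exact Finset.sum_nonneg fun x _ => hnonneg _ _ x
    · rw [hdiag]; exact Finset.sum_nonneg fun x _ => hnonneg _ _ x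
    · simp only [reducedTo, Matrix.of_apply]
      refine Finset.sum_eq_zero fun x _ => ?_
      split_ifs with hx
      · set y := Function.update x j (1, (x j).2) with hy
        have e1 : ψ 1 x = 0 := hzero 1 0 h1 x hx
        have e0 : ψ 0 y = 0 := hzero 0 1 h0 y (by simp [hy])
        -- As `j` lies outside `A`, `α 0` agrees at `x` and `y`. So `ψ 0 y = 0` forces `α 0 x = 0`,
        -- which kills `ψ 0 x`, or `β y = 0`, which kills `ψ 1 y`.
        have e01 : ψ 0 x * star (ψ 1 y) = 0 := by
          have ha : α 0 y = α 0 x := (hα 0).update_eq hj _ _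
          rw [h, ha] at e0
          rcases mul_eq_zero.1 e0 with h' | h'
          · simp [h, h']
          · simp [h, h']
        rw [mixture_apply]
        simp only [Fin.sum_univ_two, e1, e0, e01, star_zero, mul_zero, zero_mul, add_zero]
      · rfl
  | zero => simp [reducedTo_zero]
  | add N N' _ _ ih ih' =>
    obtain ⟨h1, h2, h3⟩ := ih
    obtain ⟨h1', h2', h3'⟩ := ih'
    simp only [Pi.add_apply, reducedTo_add, Matrix.add_apply]
    refine ⟨add_nonneg h1 h1', add_nonneg h2 h2', fun e1 e2 => ?_⟩
    -- The nonnegativity clauses are part of the induction so that a vanishing sum has vanishing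
    -- terms.
    rw [add_eq_zero_iff_of_nonneg h1 h1'] at e1
    rw [add_eq_zero_iff_of_nonneg h2 h2'] at e2
    rw [h3 e1.1 e2.1, h3' e1.2 e2.2, add_zero]

theorem isDensity_single (a : Fin 2) : IsDensity (Matrix.single a a (1 : ℂ)) := by
  refine ⟨?_, by simp⟩
  have : Matrix.single a a (1 : ℂ) = Matrix.vecMulVec (Pi.single a 1) (star (Pi.single a 1)) := by
    ext i k
    fin_cases a <;> fin_cases i <;> fin_cases k <;> simp [Matrix.vecMulVec_apply]
  rw [this]
  exact Matrix.posSemidef_vecMulVec_self_star _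

theorem isDensity_plusState : IsDensity plusState := by
  refine ⟨?_, by norm_num [plusState, Matrix.trace_fin_two]⟩
  have : plusState = (2⁻¹ : ℂ) • Matrix.vecMulVec 1 (star 1) := by
    ext i k
    fin_cases i <;> fin_cases k <;> simp [plusState]
  rw [this]
  refine (Matrix.posSemidef_vecMulVec_self_star _).smul ?_
  rw [Complex.nonneg_iff]
  norm_num

/-- Reduces the analysis of the algorithm, which never touches the ancillas, to vectors on the
qubits. -/
theorem localOp_kronecker_mulVec_liftVec (k : P) (A : QubitOp) (ψ : (P → Fin 2) → ℂ) :
    localOp k (Matrix.kronecker A (1 : Matrix (Fin (d + 1)) (Fin (d + 1)) ℂ)) *ᵥ liftVec d ψ =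
      liftVec d (localOp k A *ᵥ ψ) := by
  funext x
  have h0 : ∀ i b, (Matrix.kronecker A (1 : Matrix (Fin (d + 1)) (Fin (d + 1)) ℂ) :
      Matrix (LocalSys d) (LocalSys d) ℂ) (x k) (i, b) =
        if (x k).2 = b then A (x k).1 i else 0 := fun i b => by
    change A (x k).1 i * (1 : Matrix (Fin (d + 1)) (Fin (d + 1)) ℂ) (x k).2 b = _
    simp [Matrix.one_apply]
  rw [localOp_mulVec]
  simp only [Fintype.sum_prod_type, h0, liftVec, localOp_mulVec, ite_mul, zero_mul,
    Finset.sum_ite_eq, mem_univ, if_true]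
  have h1 : ∀ i, (∀ l, (Function.update x k (i, (x k).2) l).2 = 0) ↔ ∀ l, (x l).2 = 0 := by
    intro i
    refine forall_congr' fun l => ?_
    by_cases hl : l = k
    · subst hl; simp
    · simp [hl]
  have h2 : ∀ i, (fun l => (Function.update x k (i, (x k).2) l).1) =
      Function.update (fun l => (x l).1) k i := by
    intro i
    funext l
    by_cases hl : l = k
    · subst hl; simp
    · simp [hl]
  simp only [h1, h2]
  split_ifs <;> simp

theorem trace_encode {S : Subgroup (Matrix (P → Fin 2) (P → Fin 2) ℂ)ˣ}
    {e : Fin 2 → (P → Fin 2) → ℂ} (he : IsLogicalBasis S e) (ρ : QubitOp) :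
    (withAncilla d (encode e ρ)).trace = ρ.trace := by
  have h1 : (withAncilla d (encode e ρ)).trace = (encode e ρ).trace := by
    simp only [Matrix.trace, Matrix.diag_apply, withAncilla, Matrix.of_apply, and_self]
    symm
    refine Finset.sum_of_injOn (fun x k => (x k, 0)) ?_ (by simp) ?_ ?_
    · intro x _ y _ h
      funext k
      exact congrArg Prod.fst (congrFun h k)
    · intro y _ hy
      rw [if_neg]
      intro h0
      exact hy ⟨fun k => (y k).1, by simp, funext fun k => Prod.ext rfl (h0 k).symm⟩
    · intro x _
      simp
  rw [h1]
  simp only [encode, Matrix.trace_sum, Matrix.trace_smul, Matrix.trace_vecMulVec]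
  simp only [dotProduct_comm (e _), he.2.1, Matrix.trace, Matrix.diag_apply]
  simp

/-- A protocol whose outcomes are all decoded extracts. -/
theorem extracts_of_allLeaves {S : Subgroup (Matrix (P → Fin 2) (P → Fin 2) ℂ)ˣ}
    {e : Fin 2 → (P → Fin 2) → ℂ} (he : IsLogicalBasis S e) {j : P} {C : Finset P} (hj : j ∈ C)
    {Λ : Protocol P (LocalSys d)} (hΛ : Λ.IsLOCC C)
    (h : Λ.AllLeaves (IsDecoded j) fun a => liftVec d (e a)) : Extracts e j C Λ := by
  refine ⟨hΛ, fun Γ hΓ ρ hρ => ?_⟩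
  -- An outsider's operator commutes past `Λ` to the leaves, where it acts away from `j` and
  -- preserves decodedness. Hence "all leaves of `Λ` are decoded" survives any `Γ`.
  have hstable : ∀ k ∈ Cᶜ, ∀ A ψ, Λ.AllLeaves (IsDecoded (d := d) j) ψ →
      Λ.AllLeaves (IsDecoded j) fun a => localOp k A *ᵥ ψ a := by
    intro k hk A ψ hψ
    rw [mem_compl] at hk
    rw [Λ.allLeaves_localOp_iff hk A hΛ]
    exact Protocol.AllLeaves.mono (fun φ hφ => hφ.localOp (by rintro rfl; exact hk hj) A) Λ ψ hψ
  have hmem := Λ.run_mem_mixtures (fun _ => id)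
    (Γ.run_mixture_mem _ (hΓ.allLeaves hstable Γ _ h))
  obtain ⟨c, hc⟩ := exists_reducedTo_eq_smul hmem
  have hc' := hc ρ
  simp only [← withAncilla_encode] at hc'
  -- Both protocols and the encoding preserve the trace, which forces `c = 1`.
  have ht := congrArg Matrix.trace hc'
  rw [trace_reducedTo, Λ.trace_run hΛ, Γ.trace_run hΓ, trace_encode he, Matrix.trace_smul, hρ.2,
    smul_eq_mul, mul_one] at ht
  rw [hc', ← ht, one_smul]

/-- There is no extraction to `j` if the other parties can bring the code to product states with
respect to a set not containing `j`. -/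
theorem not_extracts_of_allLeaves {e : Fin 2 → (P → Fin 2) → ℂ} {j : P} {C : Finset P}
    {A : Set P} (hj : j ∉ A) {Γ : Protocol P (LocalSys d)} (hΓ : Γ.IsLOCC Cᶜ)
    (h : Γ.AllLeaves (IsProductFamily A) fun a => liftVec d (e a))
    (Λ : Protocol P (LocalSys d)) : ¬ Extracts e j C Λ := by
  rintro ⟨hΛ, hΛ'⟩
  have hmem := Λ.run_mem_mixtures
    (fun ψ hψ => hΛ.allLeaves (fun k _ B φ hφ => hφ.localOp k B) Λ ψ hψ)
    (Γ.run_mixture_mem _ h)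
  obtain ⟨-, -, h0⟩ := reducedTo_plusState_eq_zero hj hmem
  simp only [← withAncilla_encode, hΛ' Γ hΓ _ (isDensity_single _),
    hΛ' Γ hΓ _ isDensity_plusState] at h0
  -- Perfect extraction of the basis states makes both hypotheses of the criterion true, yet the
  -- off-diagonal entry of `plusState` is `1/2`.
  have := h0 (by simp) (by simp)
  norm_num [plusState] at this

end Extraction

/-! ## The steps of the extraction algorithm -/

theorem IsClifford.conjTranspose_mul_self {U : QubitOp} (h : IsClifford U) : Uᴴ * U = 1 :=
  Matrix.mem_unitaryGroup_iff'.1 h.1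

theorem IsClifford.self_mul_conjTranspose {U : QubitOp} (h : IsClifford U) : U * Uᴴ = 1 :=
  Matrix.mem_unitaryGroup_iff.1 h.1

namespace ExtractionAlgorithm

/-! ### The gates and measurements are LOCC -/

section

variable {P : Type*} {d : ℕ} {C : Finset P}

theorem isLOCC_kronecker {m : ℕ} (K : Fin m → QubitOp) (h : ∑ i, (K i)ᴴ * K i = 1) :
    ∑ i, (Matrix.kronecker (K i) (1 : Matrix (Fin (d + 1)) (Fin (d + 1)) ℂ))ᴴ *
      Matrix.kronecker (K i) (1 : Matrix (Fin (d + 1)) (Fin (d + 1)) ℂ) = 1 := by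
  have h1 : ∀ i, (Matrix.kronecker (K i) (1 : Matrix (Fin (d + 1)) (Fin (d + 1)) ℂ))ᴴ *
      Matrix.kronecker (K i) (1 : Matrix (Fin (d + 1)) (Fin (d + 1)) ℂ) =
        Matrix.kronecker ((K i)ᴴ * K i) 1 := fun i => by
    simp only [Matrix.kronecker]
    rw [Matrix.conjTranspose_kronecker, ← Matrix.mul_kronecker_mul, Matrix.conjTranspose_one,
      one_mul]
  simp only [h1]
  have h2 : ∑ i, Matrix.kronecker ((K i)ᴴ * K i) (1 : Matrix (Fin (d + 1)) (Fin (d + 1)) ℂ) =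
      Matrix.kronecker (∑ i, (K i)ᴴ * K i) 1 := by
    ext x y
    simp [Matrix.sum_apply, Matrix.kronecker, Finset.sum_mul]
  rw [h2, h]
  exact Matrix.one_kronecker_one

theorem isLOCC_gate {k : P} (hk : k ∈ C) {A : QubitOp} (hA : Aᴴ * A = 1)
    {next : Protocol P (LocalSys d)} (h : next.IsLOCC C) : (gate k A next).IsLOCC C :=
  ⟨hk, isLOCC_kronecker (fun _ : Fin 1 => A) (by simpa using hA), fun _ => h⟩

theorem isLOCC_gates {L : List P} (hL : ∀ k ∈ L, k ∈ C) {A : P → QubitOp}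
    (hA : ∀ k, (A k)ᴴ * A k = 1) {next : Protocol P (LocalSys d)} (h : next.IsLOCC C) :
    (gates A L next).IsLOCC C := by
  induction L with
  | nil => exact h
  | cons v L ih =>
    rw [List.forall_mem_cons] at hL
    exact isLOCC_gate hL.1 (hA v) (ih hL.2)

theorem isLOCC_measureZ {k : P} (hk : k ∈ C) {next : Fin 2 → Protocol P (LocalSys d)}
    (h : ∀ i, (next i).IsLOCC C) : (measureZ k next).IsLOCC C := by
  refine ⟨hk, isLOCC_kronecker
    (fun i : Fin 2 => (![!![1, 0; 0, 0], !![0, 0; 0, 1]] i : QubitOp)) ?_, h⟩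
  ext a b
  fin_cases a <;> fin_cases b <;> simp [Fin.sum_univ_two, Matrix.mul_apply]

theorem isLOCC_measureX {k : P} (hk : k ∈ C) {next : Fin 2 → Protocol P (LocalSys d)}
    (h : ∀ i, (next i).IsLOCC C) : (measureX k next).IsLOCC C := by
  refine ⟨hk, isLOCC_kronecker
    (fun i : Fin 2 => ((2 : ℂ)⁻¹ • ![!![1, 1; 1, 1], !![1, -1; -1, 1]] i : QubitOp)) ?_, h⟩
  ext a b
  fin_cases a <;> fin_cases b <;> norm_num [Fin.sum_univ_two, Matrix.mul_apply]

theorem isLOCC_measureAllZ [DecidableEq P] {L : List P} (hL : ∀ k ∈ L, k ∈ C) {s : P → Fin 2}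
    {next : (P → Fin 2) → Protocol P (LocalSys d)} (h : ∀ t, (next t).IsLOCC C) :
    (measureAllZ L s next).IsLOCC C := by
  induction L generalizing s with
  | nil => exact h s
  | cons v L ih =>
    rw [List.forall_mem_cons] at hL
    exact isLOCC_measureZ hL.1 fun i => ih hL.2

end

/-! ### Leaves after gates and measurements -/

section

variable {P : Type*} [Fintype P] [DecidableEq P] {d : ℕ}
  {T : (Fin 2 → (P → LocalSys d) → ℂ) → Prop} {C : Finset P}

theorem allLeaves_gate (k : P) (A : QubitOp) (next : Protocol P (LocalSys d))
    (ψ : Fin 2 → (P → Fin 2) → ℂ) :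
    ((gate k A next).AllLeaves T fun a => liftVec d (ψ a)) ↔
      next.AllLeaves T fun a => liftVec d (localOp k A *ᵥ ψ a) := by
  simp only [gate, Protocol.AllLeaves, localOp_kronecker_mulVec_liftVec, forall_const]

theorem allLeaves_gates (A : P → QubitOp) (L : List P) (next : Protocol P (LocalSys d))
    (ψ : Fin 2 → (P → Fin 2) → ℂ) :
    ((gates A L next).AllLeaves T fun a => liftVec d (ψ a)) ↔
      next.AllLeaves T fun a => liftVec d (applyGates A L (ψ a)) := by
  induction L generalizing ψ with
  | nil => rfl
  | cons v L ih => exact (allLeaves_gate v (A v) (gates A L next) ψ).trans (ih _)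

theorem localOp_project_mulVec (k : P) (i : Fin 2) (ψ : (P → Fin 2) → ℂ) (x : P → Fin 2) :
    (localOp k (![!![1, 0; 0, 0], !![0, 0; 0, 1]] i : QubitOp) *ᵥ ψ) x =
      if x k = i then ψ x else 0 := by
  rw [localOp_mulVec, Fin.sum_univ_two]
  have h : ψ (Function.update x k (x k)) = ψ x := by rw [Function.update_eq_self]
  obtain hx | hx : x k = 0 ∨ x k = 1 := by omega
  all_goals
    rw [hx] at h
    fin_cases i <;> simp [hx, h]

theorem allLeaves_measureAllZ (L : List P) (hL : L.Nodup) (s : P → Fin 2)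
    (next : (P → Fin 2) → Protocol P (LocalSys d)) (ψ : Fin 2 → (P → Fin 2) → ℂ)
    (h : ∀ t : P → Fin 2, (next t).AllLeaves T fun a =>
      liftVec d fun x => if ∀ k ∈ L, x k = t k then ψ a x else 0) :
    (measureAllZ L s next).AllLeaves T fun a => liftVec d (ψ a) := by
  -- The induction only demands the hypothesis for records `t` agreeing with `s` off `L`; this
  -- identifies `t v` with the outcome `i` just written, as `v` is not measured again.
  suffices H : ∀ (L : List P), L.Nodup → ∀ (s : P → Fin 2) (ψ : Fin 2 → (P → Fin 2) → ℂ),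
      (∀ t : P → Fin 2, (∀ k ∉ L, t k = s k) → (next t).AllLeaves T fun a =>
        liftVec d fun x => if ∀ k ∈ L, x k = t k then ψ a x else 0) →
      (measureAllZ L s next).AllLeaves T fun a => liftVec d (ψ a) from
    H L hL s ψ fun t _ => h t
  intro L
  induction L with
  | nil => intro _ s ψ h; rw [measureAllZ]; simpa using h s (by simp)
  | cons v L ih =>
    intro hL s ψ h i
    rw [List.nodup_cons] at hL
    simp only [localOp_kronecker_mulVec_liftVec]
    refine ih hL.2 _ _ fun t ht => ?_
    have htv : t v = i := by simpa using ht v hL.1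
    convert h t fun k hk => ?_ using 4 with a x
    · simp only [localOp_project_mulVec, List.forall_mem_cons, htv]
      split_ifs <;> tauto
    · simp only [List.mem_cons, not_or] at hk
      rw [ht k hk.2, Function.update_of_ne hk.1]

theorem allLeaves_measureX (k : P) (next next' : Protocol P (LocalSys d))
    (ψ : Fin 2 → (P → Fin 2) → ℂ) :
    ((measureX k ![next, next']).AllLeaves T fun a => liftVec d (ψ a)) ↔
      (next.AllLeaves T fun a => liftVec d
        (localOp k ((2 : ℂ)⁻¹ • !![1, 1; 1, 1] : QubitOp) *ᵥ ψ a)) ∧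
      next'.AllLeaves T fun a => liftVec d
        (localOp k ((2 : ℂ)⁻¹ • !![1, -1; -1, 1] : QubitOp) *ᵥ ψ a) := by
  simp only [measureX, Protocol.AllLeaves, localOp_kronecker_mulVec_liftVec, Fin.forall_fin_two]
  rfl

end

/-! ### Unitarity of the gates -/

theorem sqrt_two_inv_mul_self : ((√2 : ℝ) : ℂ)⁻¹ * ((√2 : ℝ) : ℂ)⁻¹ = 2⁻¹ := by
  rw [← mul_inv, ← Complex.ofReal_mul, Real.mul_self_sqrt (by norm_num)]
  norm_num

theorem isometry_mul {A B : QubitOp} (hA : Aᴴ * A = 1) (hB : Bᴴ * B = 1) :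
    (A * B)ᴴ * (A * B) = 1 := by
  rw [Matrix.conjTranspose_mul, Matrix.mul_assoc, ← Matrix.mul_assoc Aᴴ, hA, one_mul, hB]

theorem isometry_sqrt_two_smul {A : QubitOp} (h : Aᴴ * A = (2 : ℂ) • 1) :
    (((√2 : ℝ) : ℂ)⁻¹ • A)ᴴ * (((√2 : ℝ) : ℂ)⁻¹ • A) = 1 := by
  rw [Matrix.conjTranspose_smul, Matrix.smul_mul, Matrix.mul_smul, smul_smul, h, smul_smul]
  have : star (((√2 : ℝ) : ℂ)⁻¹) = ((√2 : ℝ) : ℂ)⁻¹ := by simp [Complex.conj_ofReal]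
  rw [this, sqrt_two_inv_mul_self]
  simp

theorem isometry_pauliZ_pow (m : ℕ) : (pauliZ ^ m)ᴴ * pauliZ ^ m = 1 := by
  have h : pauliZᴴ * pauliZ = 1 := by
    ext a b
    fin_cases a <;> fin_cases b <;> simp [pauliZ, Matrix.mul_apply]
  induction m with
  | zero => simp
  | succ m ih => rw [pow_succ]; exact isometry_mul ih h

theorem isometry_hadamard : hadamardᴴ * hadamard = 1 := by
  refine isometry_sqrt_two_smul ?_
  ext a b
  fin_cases a <;> fin_cases b <;> norm_num [Matrix.mul_apply]

theorem one_sub_I_smul_pauliY : 1 - Complex.I • pauliY = !![1, -1; 1, 1] := by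
  ext a b
  fin_cases a <;> fin_cases b <;> simp [pauliY]

theorem one_add_I_smul_pauliY : 1 + Complex.I • pauliY = !![1, 1; -1, 1] := by
  ext a b
  fin_cases a <;> fin_cases b <;> simp [pauliY]

theorem isometry_rootPlus : rootPlusᴴ * rootPlus = 1 := by
  refine isometry_sqrt_two_smul ?_
  rw [one_sub_I_smul_pauliY]
  ext a b
  fin_cases a <;> fin_cases b <;> norm_num [Matrix.mul_apply]

theorem isometry_rootMinus : rootMinusᴴ * rootMinus = 1 := by
  refine isometry_sqrt_two_smul ?_
  rw [one_add_I_smul_pauliY]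
  ext a b
  fin_cases a <;> fin_cases b <;> norm_num [Matrix.mul_apply]

theorem isometry_transpose {A : QubitOp} (h : A * Aᴴ = 1) : Aᵀᴴ * Aᵀ = 1 := by
  have := congrArg Matrix.transpose h
  rw [Matrix.transpose_mul, Matrix.transpose_one] at this
  exact this

theorem isLOCC_alongPath {P : Type*} [Fintype P] [DecidableEq P] {d : ℕ} {C : Finset P} {j : P}
    (hj : j ∈ C) {UR : QubitOp} (hUR : UR * URᴴ = 1) (m : ℕ) (L : List P)
    (hL : ∀ k ∈ L, k ∈ C) : (alongPath (d := d) j UR m L).IsLOCC C := by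
  have hend : ∀ m, (URᵀ * pauliZ ^ m * hadamard)ᴴ * (URᵀ * pauliZ ^ m * hadamard) = 1 := fun m =>
    isometry_mul (isometry_mul (isometry_transpose hUR) (isometry_pauliZ_pow m)) isometry_hadamard
  induction L with
  | nil => exact isLOCC_gate hj (hend m) trivial
  | cons v L ih =>
    rw [List.forall_mem_cons] at hL
    cases L with
    | nil =>
      refine isLOCC_measureX hL.1 fun i => ?_
      fin_cases i
      · exact isLOCC_gate hj (isometry_mul (hend _) isometry_rootPlus) trivial
      · exact isLOCC_gate hj (isometry_mul (hend _) isometry_rootMinus) trivial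
    | cons w L =>
      refine isLOCC_measureX hL.1 fun i => ?_
      fin_cases i
      · exact isLOCC_gate hj isometry_rootPlus (isLOCC_gate (hL.2 w (by simp))
          (by simpa using isometry_pauliZ_pow 1) (ih hL.2))
      · exact isLOCC_gate hj isometry_rootMinus (ih hL.2)

end ExtractionAlgorithm

/-! ### Signs -/

/-- The sign `(-1) ^ (a * b)`. -/
def cSign (a b : Fin 2) : ℂ := if a = 1 ∧ b = 1 then -1 else 1

theorem cSign_comm (a b : Fin 2) : cSign a b = cSign b a := by
  simp only [cSign, and_comm]

theorem cSign_zero_left (b : Fin 2) : cSign 0 b = 1 := by simp [cSign]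

theorem cSign_one_add (a b : Fin 2) : cSign (1 + a) b = cSign 1 b * cSign a b := by
  fin_cases a <;> fin_cases b <;> simp [cSign]

theorem cSign_mul_self (a b : Fin 2) : cSign a b * cSign a b = 1 := by
  simp only [cSign]
  split_ifs <;> simp

/-- The product of the signs of the edges of the path through the parties `k :: L` that ends in
the reference, the value of which is `r`. -/
def chainSign {P : Type*} (y : P → Fin 2) (r : Fin 2) : P → List P → ℂ
  | k, [] => cSign (y k) r
  | k, v :: L => cSign (y k) (y v) * chainSign y r v L

theorem chainSign_update {P : Type*} [DecidableEq P] (y : P → Fin 2) (r : Fin 2) {j : P}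
    (i : Fin 2) (k : P) (L : List P) (h : j ∉ k :: L) :
    chainSign (Function.update y j i) r k L = chainSign y r k L := by
  induction L generalizing k with
  | nil =>
    have : k ≠ j := by rintro rfl; simp at h
    simp [chainSign, this]
  | cons v L ih =>
    rw [List.mem_cons, not_or] at h
    have h1 : v ≠ j := by rintro rfl; simp at h
    rw [chainSign, chainSign, ih v h.2, Function.update_of_ne (Ne.symm h.1),
      Function.update_of_ne h1]

/-! ### Decoding along the path -/

namespace ExtractionAlgorithm

section

variable {P : Type*} [Fintype P] [DecidableEq P]

theorem pauliZ_pow (m : ℕ) : pauliZ ^ m = Matrix.diagonal fun i => cSign 1 i ^ m := by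
  have : pauliZ = Matrix.diagonal fun i => cSign 1 i := by
    ext a b
    fin_cases a <;> fin_cases b <;> simp [pauliZ, cSign]
  rw [this, Matrix.diagonal_pow]
  rfl

theorem localOp_pauliZ_pow_mulVec (k : P) (m : ℕ) (ψ : (P → Fin 2) → ℂ) (y : P → Fin 2) :
    (localOp k (pauliZ ^ m) *ᵥ ψ) y = cSign 1 (y k) ^ m * ψ y := by
  rw [localOp_mulVec, pauliZ_pow, Finset.sum_eq_single (y k)]
  · simp
  · intro i _ hi
    rw [Matrix.diagonal_apply_ne _ hi.symm, zero_mul]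
  · simp

theorem applyGates_pauliZ_pow (c : P → ℕ) (L : List P) (ψ : (P → Fin 2) → ℂ) (y : P → Fin 2) :
    applyGates (fun k => pauliZ ^ c k) L ψ y =
      (L.map fun k => cSign 1 (y k) ^ c k).prod * ψ y := by
  induction L generalizing ψ with
  | nil => simp [applyGates]
  | cons v L ih =>
    have : applyGates (fun k => pauliZ ^ c k) (v :: L) ψ =
      applyGates (fun k => pauliZ ^ c k) L (localOp v (pauliZ ^ c v) *ᵥ ψ) := rfl
    rw [this, ih, localOp_pauliZ_pow_mulVec, List.map_cons, List.prod_cons]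
    ring

/-- The final operation at `j` decodes. -/
theorem localOp_final_mulVec {j : P} {UR : QubitOp} (hUR : URᴴ * UR = 1) (m : ℕ)
    (h : (P → Fin 2) → ℂ) (hh : ∀ y i, h (Function.update y j i) = h y)
    (ψ : Fin 2 → (P → Fin 2) → ℂ)
    (hψ : ∀ a y, ψ a y = h y * ∑ r, star (UR r a) * cSign 1 r ^ m * cSign (y j) r)
    (a : Fin 2) (y : P → Fin 2) :
    (localOp j (URᵀ * pauliZ ^ m * hadamard) *ᵥ ψ a) y =
      if y j = a then (2 * ((√2 : ℝ) : ℂ)⁻¹) * h y else 0 := by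
  have hU : ∀ q, star (UR 0 a) * UR 0 q + star (UR 1 a) * UR 1 q = if q = a then 1 else 0 := by
    intro q
    have := congrFun (congrFun hUR a) q
    simp only [Matrix.mul_apply, Fin.sum_univ_two, Matrix.conjTranspose_apply,
      Matrix.one_apply] at this
    rw [this]
    simp only [eq_comm]
  -- The sign in the state cancels against the gate `pauliZ ^ m`; the Hadamard gate inverts `cSign
  -- (y j) r`, and `hU` inverts the reference operator.
  have hZ : ((-1 : ℂ) ^ m) * (-1) ^ m = 1 := by rw [← mul_pow]; simp
  rw [localOp_mulVec]
  simp only [hψ, hh, Function.update_self, Fin.sum_univ_two, pauliZ_pow, _root_.hadamard,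
    Matrix.mul_apply, Matrix.diagonal_apply, Matrix.transpose_apply, Matrix.smul_apply]
  rw [show (if y j = a then (2 * ((√2 : ℝ) : ℂ)⁻¹) * h y else 0) =
    (2 * ((√2 : ℝ) : ℂ)⁻¹) * h y * (if y j = a then 1 else 0) by split_ifs <;> simp, ← hU (y j)]
  simp [cSign]
  linear_combination (((√2 : ℝ) : ℂ)⁻¹ * h y * 2 * UR 1 (y j) *
    (starRingEnd ℂ) (UR 1 a)) * hZ

theorem isDecoded_liftVec {d : ℕ} {j : P} (h : (P → Fin 2) → ℂ)
    (hh : ∀ y i, h (Function.update y j i) = h y) (ψ : Fin 2 → (P → Fin 2) → ℂ)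
    (hψ : ∀ a y, ψ a y = if y j = a then h y else 0) :
    IsDecoded j fun a => liftVec d (ψ a) := by
  refine ⟨liftVec d h, fun x b => ?_, fun a x => ?_⟩
  · have h1 : (∀ l, (Function.update x j (b, (x j).2) l).2 = 0) ↔ ∀ l, (x l).2 = 0 := by
      refine forall_congr' fun l => ?_
      by_cases hl : l = j
      · subst hl; simp
      · simp [hl]
    have h2 : (fun l => (Function.update x j (b, (x j).2) l).1) =
        Function.update (fun l => (x l).1) j b := by
      funext l
      by_cases hl : l = j
      · subst hl; simp
      · simp [hl]
    simp only [liftVec, h1, h2, hh]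
  · simp only [liftVec, hψ]
    split_ifs <;> rfl

/-- Projecting `v` onto `|+⟩` leaves `F₀ + F₁` at `y j = 0` and `F₀ - F₁` at `y j = 1`, where `Fₜ`
is `F` with `v` set to `t`. The rotation recombines these to `F₁` and `F₀`: `j` replaces `v` in the
chain, with flipped value. -/
theorem localOp_rootPlus_mulVec {j v : P} (hjv : j ≠ v) (h F : (P → Fin 2) → ℂ)
    (hj : ∀ y i, h (Function.update y j i) = h y) (hv : ∀ y i, h (Function.update y v i) = h y)
    (hF : ∀ y i, F (Function.update y j i) = F y) (ψ : (P → Fin 2) → ℂ)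
    (hψ : ∀ y, ψ y = h y * (cSign (y j) (y v) * F y)) (y : P → Fin 2) :
    (localOp j rootPlus *ᵥ (localOp v ((2 : ℂ)⁻¹ • !![1, 1; 1, 1] : QubitOp) *ᵥ ψ)) y =
      ((√2 : ℝ) : ℂ)⁻¹ * h y * F (Function.update y v (1 + y j)) := by
  simp only [localOp_mulVec, hψ, Function.update_comm hjv, hF, hv, hj, Function.update_self,
    Function.update_of_ne hjv.symm, rootPlus, one_sub_I_smul_pauliY,
    Fin.sum_univ_two]
  obtain hy | hy : y j = 0 ∨ y j = 1 := by omega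
  all_goals
    obtain hw | hw : y v = 0 ∨ y v = 1 := by omega
    all_goals
      simp [hy, hw, cSign]
      ring

/-- For `|-⟩` the two combinations are interchanged, so the opposite rotation lets `j` replace `v`
without a flip; the sign at `v` is the residual state `|-⟩`. -/
theorem localOp_rootMinus_mulVec {j v : P} (hjv : j ≠ v) (h F : (P → Fin 2) → ℂ)
    (hj : ∀ y i, h (Function.update y j i) = h y) (hv : ∀ y i, h (Function.update y v i) = h y)
    (hF : ∀ y i, F (Function.update y j i) = F y) (ψ : (P → Fin 2) → ℂ)
    (hψ : ∀ y, ψ y = h y * (cSign (y j) (y v) * F y)) (y : P → Fin 2) :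
    (localOp j rootMinus *ᵥ (localOp v ((2 : ℂ)⁻¹ • !![1, -1; -1, 1] : QubitOp) *ᵥ ψ)) y =
      ((√2 : ℝ) : ℂ)⁻¹ * cSign 1 (y v) * h y * F (Function.update y v (y j)) := by
  simp only [localOp_mulVec, hψ, Function.update_comm hjv, hF, hv, hj, Function.update_self,
    Function.update_of_ne hjv.symm, rootMinus, one_add_I_smul_pauliY,
    Fin.sum_univ_two]
  obtain hy | hy : y j = 0 ∨ y j = 1 := by omega
  all_goals
    obtain hw | hw : y v = 0 ∨ y v = 1 := by omega
    all_goals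
      simp [hy, hw, cSign]
      ring

/-- The prefactor `h` collects everything that does not involve `j` and the parties still in the
chain. Measuring `v` removes it from the chain and moves its residual state into `h`, so the form of
the state is kept with a shorter list. -/
theorem allLeaves_alongPath {d : ℕ} {j : P} {UR : QubitOp} (hUR : URᴴ * UR = 1) (m : ℕ)
    (L : List P) (hL : (j :: L).Nodup) (h : (P → Fin 2) → ℂ)
    (hh : ∀ k ∈ j :: L, ∀ y i, h (Function.update y k i) = h y)
    (ψ : Fin 2 → (P → Fin 2) → ℂ)
    (hψ : ∀ a y, ψ a y = h y * ∑ r, star (UR r a) * cSign 1 r ^ m * chainSign y r j L) :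
    (alongPath j UR m L).AllLeaves (IsDecoded j) fun a => liftVec d (ψ a) := by
  induction L generalizing h ψ with
  | nil =>
    refine (allLeaves_gate _ _ _ _).2 ?_
    have hj := hh j (by simp)
    exact isDecoded_liftVec _ (fun y i => by rw [hj]) _
      (localOp_final_mulVec hUR m h hj ψ hψ)
  | cons v L ih =>
    have hjv : j ≠ v := by rintro rfl; simp at hL
    have hj := hh j (by simp)
    have hv := hh v (by simp)
    have hψ' : ∀ a y, ψ a y = h y * (cSign (y j) (y v) *
        ∑ r, star (UR r a) * cSign 1 r ^ m * chainSign y r v L) := by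
      intro a y
      rw [hψ]
      congr 1
      rw [Finset.mul_sum]
      refine Finset.sum_congr rfl fun r _ => ?_
      rw [chainSign]
      ring
    have hF : ∀ a y i, (∑ r, star (UR r a) * cSign 1 r ^ m *
        chainSign (Function.update y j i) r v L) =
          ∑ r, star (UR r a) * cSign 1 r ^ m * chainSign y r v L := by
      intro a y i
      simp only [chainSign_update y _ i v L (List.nodup_cons.1 hL).1]
    have hplus := fun a => localOp_rootPlus_mulVec hjv h _ hj hv (hF a) (ψ a) (hψ' a)
    have hminus := fun a => localOp_rootMinus_mulVec hjv h _ hj hv (hF a) (ψ a) (hψ' a)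
    cases L with
    | nil =>
      refine (allLeaves_measureX _ _ _ _).2 ⟨?_, ?_⟩
      · rw [allLeaves_gate]
        simp only [← localOp_mulVec_mulVec j _ rootPlus]
        refine isDecoded_liftVec _ (fun y i => ?_) _
          -- The flip on outcome `+` adds the sign `cSign 1 r` at the reference, where no party can
          -- act; raising `m` by one lets the last gate absorb it.
          (localOp_final_mulVec hUR (m + 1) (fun y => ((√2 : ℝ) : ℂ)⁻¹ * h y) (fun y i => ?_)
            (fun a => localOp j rootPlus *ᵥ (localOp v _ *ᵥ ψ a)) fun a y => ?_)
        · simp only [hj]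
        · simp only [hj]
        · rw [hplus a y]
          congr 1
          refine Finset.sum_congr rfl fun r _ => ?_
          rw [chainSign, Function.update_self, cSign_one_add]
          ring
      · rw [allLeaves_gate]
        simp only [← localOp_mulVec_mulVec j _ rootMinus]
        refine isDecoded_liftVec _ (fun y i => ?_) _
          (localOp_final_mulVec hUR m (fun y => ((√2 : ℝ) : ℂ)⁻¹ * cSign 1 (y v) * h y)
            (fun y i => ?_) (fun a => localOp j rootMinus *ᵥ (localOp v _ *ᵥ ψ a)) fun a y => ?_)
        · simp only [hj, Function.update_of_ne hjv.symm]
        · simp only [hj, Function.update_of_ne hjv.symm]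
        · rw [hminus a y]
          congr 1
          refine Finset.sum_congr rfl fun r _ => ?_
          rw [chainSign, Function.update_self]
    | cons w L =>
      have hnd : (j :: w :: L).Nodup := by
        simp only [List.nodup_cons, List.mem_cons, not_or] at hL ⊢
        tauto
      have hsub : ∀ k ∈ j :: w :: L, k ∈ j :: v :: w :: L := by
        intro k hk
        simp only [List.mem_cons] at hk ⊢
        tauto
      have hvL : v ∉ w :: L := (List.nodup_cons.1 (List.nodup_cons.1 hL).2).1
      have hvw : w ≠ v := by rintro rfl; simp at hvL
      refine (allLeaves_measureX _ _ _ _).2 ⟨?_, ?_⟩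
      · rw [allLeaves_gate, allLeaves_gate]
        refine ih hnd (fun y => ((√2 : ℝ) : ℂ)⁻¹ * h y) (fun k hk y i => ?_) _ fun a y => ?_
        · simp only [hh k (hsub k hk)]
        · rw [← pow_one pauliZ, localOp_pauliZ_pow_mulVec, hplus a y]
          simp only [Finset.mul_sum]
          refine Finset.sum_congr rfl fun r _ => ?_
          rw [chainSign, chainSign, Function.update_self, Function.update_of_ne hvw,
            chainSign_update _ _ _ _ _ hvL, cSign_one_add]
          -- The sign caused by the flip cancels against the gate `pauliZ` at `w`.
          linear_combination (((√2 : ℝ) : ℂ)⁻¹ * h y * star (UR r a) * cSign 1 r ^ m *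
            cSign (y j) (y w) * chainSign y r w L) * cSign_mul_self 1 (y w)
      · rw [allLeaves_gate]
        refine ih hnd (fun y => ((√2 : ℝ) : ℂ)⁻¹ * cSign 1 (y v) * h y)
          (fun k hk y i => ?_) _ fun a y => ?_
        · have hkv : v ≠ k := by
            rintro rfl
            rcases List.mem_cons.1 hk with hk | hk
            · exact hjv hk.symm
            · exact hvL hk
          simp only [hh k (hsub k hk), Function.update_of_ne hkv]
        · rw [hminus a y]
          congr 1
          refine Finset.sum_congr rfl fun r _ => ?_
          rw [chainSign, chainSign, Function.update_self, Function.update_of_ne hvw,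
            chainSign_update _ _ _ _ _ hvL]

end

end ExtractionAlgorithm

/-! ## Trees -/

namespace SimpleGraph

variable {V : Type*} {G : SimpleGraph V}

/-- Every edge of a forest is a bridge. The statements about paths below come from exhibiting a
suitable walk between the ends of an edge. -/
theorem IsAcyclic.mem_edges_of_adj (hG : G.IsAcyclic) {u v : V} (h : G.Adj u v)
    (q : G.Walk u v) : s(u, v) ∈ q.edges :=
  isBridge_iff_forall_walk_mem_edges.1 (isAcyclic_iff_forall_adj_isBridge.1 hG h) q

theorem Walk.exists_walk_edges_subset [DecidableEq V] {a b : V} (p : G.Walk a b) {u v : V}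
    (hu : u ∈ p.support) (hv : v ∈ p.support) :
    ∃ q : G.Walk u v, ∀ ε ∈ q.edges, ε ∈ p.edges := by
  refine ⟨(p.takeUntil u hu).reverse.append (p.takeUntil v hv), fun ε hε => ?_⟩
  rw [Walk.edges_append, List.mem_append, Walk.edges_reverse, List.mem_reverse] at hε
  rcases hε with h | h
  · exact p.edges_takeUntil_subset_edges hu h
  · exact p.edges_takeUntil_subset_edges hv h

theorem IsAcyclic.mem_edges_of_adj_of_mem_support [DecidableEq V] (hG : G.IsAcyclic) {a b : V}
    (p : G.Walk a b) {u v : V} (hu : u ∈ p.support) (hv : v ∈ p.support) (h : G.Adj u v) :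
    s(u, v) ∈ p.edges := by
  obtain ⟨q, hq⟩ := p.exists_walk_edges_subset hu hv
  exact hq _ (hG.mem_edges_of_adj h q)

/-- A vertex off a path of a forest has at most one neighbour on the path. -/
theorem IsAcyclic.eq_of_adj_of_mem_support [DecidableEq V] (hG : G.IsAcyclic) {a b : V}
    (p : G.Walk a b) {w v v' : V} (hw : w ∉ p.support) (hv : v ∈ p.support)
    (hv' : v' ∈ p.support) (h : G.Adj w v) (h' : G.Adj w v') : v = v' := by
  obtain ⟨q, hq⟩ := p.exists_walk_edges_subset hv' hv
  -- The walk from `w` to `v'` and along the path to `v` must use the edge `wv`, which is not an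
  -- edge of the path because `w` is off it.
  have := hG.mem_edges_of_adj h (Walk.cons h' q)
  rw [Walk.edges_cons, List.mem_cons] at this
  rcases this with h | h
  · exact Sym2.congr_right.1 h
  · exact absurd (p.fst_mem_support_of_mem_edges (hq _ h)) hw

/-- The branches of a forest at different vertices next to a path do not meet. -/
theorem IsAcyclic.eq_of_common_neighbor [DecidableEq V] (hG : G.IsAcyclic) {a b : V}
    (p : G.Walk a b) {w w' v v' u : V} (hw : w ∉ p.support) (hw' : w' ∉ p.support)
    (hu : u ∉ p.support) (hv : v ∈ p.support) (hv' : v' ∈ p.support) (h : G.Adj w v)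
    (h' : G.Adj w' v') (hwu : u = w ∨ G.Adj w u) (hwu' : u = w' ∨ G.Adj w' u) : w = w' := by
  obtain ⟨q, hq⟩ := p.exists_walk_edges_subset hv' hv
  -- If both branches contain `u`, they join `w` to `w'` off the path; going on through `v'` along
  -- the path to `v` gives a walk that must use the edge `wv`.
  obtain ⟨r, hr⟩ : ∃ r : G.Walk w w', ∀ x ∈ r.support, x ∉ p.support := by
    rcases hwu with rfl | hwu <;> rcases hwu' with rfl | hwu'
    · exact ⟨Walk.nil, by simpa using hw⟩
    · exact ⟨Walk.cons hwu'.symm Walk.nil, by simp [hw, hw']⟩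
    · exact ⟨Walk.cons hwu Walk.nil, by simp [hw, hw']⟩
    · exact ⟨Walk.cons hwu (Walk.cons hwu'.symm Walk.nil), by simp [hw, hw', hu]⟩
  have := hG.mem_edges_of_adj h ((r.append (Walk.cons h' Walk.nil)).append q)
  simp only [Walk.edges_append, Walk.edges_cons, Walk.edges_nil, List.mem_append,
    List.mem_singleton] at this
  rcases this with (h1 | h1) | h1
  · exact absurd hv (hr v (r.snd_mem_support_of_mem_edges h1))
  · rcases Sym2.eq_iff.1 h1 with ⟨h2, -⟩ | ⟨h2, -⟩
    · exact h2
    · exact absurd (h2 ▸ hv') hw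
  · exact absurd (p.fst_mem_support_of_mem_edges (hq _ h1)) hw

/-- Ensures that a neighbourhood defined by adjacency alone contains the path itself. -/
theorem Walk.exists_adj_mem_support {a b : V} (p : G.Walk a b) (hp : ¬ p.Nil) {x : V}
    (hx : x ∈ p.support) : ∃ l ∈ p.support, G.Adj x l := by
  induction p with
  | nil => simp at hp
  | @cons u v w h q ih =>
    rw [Walk.support_cons, List.mem_cons] at hx
    rcases hx with rfl | hx
    · exact ⟨v, by simp, h⟩
    · cases q with
      | nil =>
        rw [Walk.support_nil, List.mem_singleton] at hx
        subst hx
        exact ⟨u, by simp, h.symm⟩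
      | cons h' q =>
        obtain ⟨l, hl, hxl⟩ := ih (by simp) hx
        exact ⟨l, by rw [Walk.support_cons]; exact List.mem_cons_of_mem _ hl, hxl⟩

/-- Every vertex `v` of a path of a forest, except for its first one, separates the first vertex
of the path from the last one. -/
theorem IsAcyclic.exists_separating_set [DecidableEq V] (hG : G.IsAcyclic) {a b : V}
    (hab : a ≠ b) (p : G.Walk a b) (hp : p.IsPath) {v : V} (hv : v ∈ p.support) :
    ∃ X : Set V, b ∈ X ∧ a ∉ X ∧ ∀ x ∈ X, ∀ y ∉ X, G.Adj x y → x = v ∨ y = v := by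
  -- These are the vertices reached from `b` while avoiding `v`; `b` is added by hand because no
  -- such walk exists when `v = b`.
  refine ⟨{x | x = b ∨ ∃ q : G.Walk b x, v ∉ q.support}, Or.inl rfl, ?_, ?_⟩
  · rintro (h | ⟨q, hq⟩)
    · exact hab h
    · have := congrArg Subtype.val ((hG.subsingleton_path b a).elim ⟨p.reverse, hp.reverse⟩ q.toPath)
      apply hq
      apply q.support_bypass_subset_support
      have h2 : p.reverse = q.bypass := this
      rw [← h2, Walk.support_reverse, List.mem_reverse]
      exact hv
  · intro x hx y hy hxy
    by_contra! hne
    refine hy (Or.inr ?_)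
    rcases hx with rfl | ⟨q, hq⟩
    · exact ⟨Walk.cons hxy Walk.nil, by simp [hne.1.symm, hne.2.symm]⟩
    · exact ⟨q.append (Walk.cons hxy Walk.nil), by
        simp [Walk.support_append, hq, hne.2.symm]⟩

end SimpleGraph

/-! ## Amplitudes of graph states -/

section GraphSigns

variable {V : Type*}

open Classical in
/-- The sign contributed by an edge to the amplitude of a graph state. -/
noncomputable def edgeSign (z : V → Fin 2) (ε : Sym2 V) : ℂ :=
  if ∀ v ∈ ε, z v = 1 then -1 else 1

theorem edgeSign_mk (z : V → Fin 2) (u v : V) : edgeSign z s(u, v) = cSign (z u) (z v) := by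
  simp [edgeSign, cSign]

theorem edgeSign_congr {z z' : V → Fin 2} {ε : Sym2 V} (h : ∀ v ∈ ε, z v = z' v) :
    edgeSign z ε = edgeSign z' ε := by
  have : (∀ v ∈ ε, z v = 1) ↔ ∀ v ∈ ε, z' v = 1 := forall₂_congr fun v hv => by rw [h v hv]
  classical
  unfold edgeSign
  exact if_congr this rfl rfl

variable [Fintype V]

open Classical in
/-- The sign of an amplitude of a graph state. -/
noncomputable def graphSign (G : SimpleGraph V) (z : V → Fin 2) : ℂ :=
  ∏ ε ∈ G.edgeFinset, edgeSign z ε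

theorem graphSign_update [DecidableEq V] (G : SimpleGraph V) [DecidableRel G.Adj] (z : V → Fin 2) (w : V) (t : Fin 2) :
    graphSign G (Function.update z w t) =
      (∏ u ∈ univ.filter (G.Adj w), cSign t (z u)) * graphSign G (Function.update z w 0) := by
  have h3 : ∀ z' : V → Fin 2, graphSign G z' =
      (∏ ε ∈ G.edgeFinset with w ∈ ε, edgeSign z' ε) *
        ∏ ε ∈ G.edgeFinset with w ∉ ε, edgeSign z' ε := fun z' => by
    rw [Finset.prod_filter_mul_prod_filter_not, graphSign]
    congr!
  have h0 : ∏ ε ∈ G.edgeFinset with w ∈ ε, edgeSign (Function.update z w 0) ε = 1 := by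
    refine Finset.prod_eq_one fun ε hε => ?_
    rw [edgeSign, if_neg]
    intro h
    simpa using h w (mem_filter.1 hε).2
  have h1 : ∀ t, ∏ ε ∈ G.edgeFinset with w ∉ ε, edgeSign (Function.update z w t) ε =
      ∏ ε ∈ G.edgeFinset with w ∉ ε, edgeSign z ε := fun t =>
    Finset.prod_congr rfl fun ε hε => edgeSign_congr fun v hv =>
      Function.update_of_ne (by rintro rfl; exact (mem_filter.1 hε).2 hv) _ _
  have h2 : ∏ ε ∈ G.edgeFinset with w ∈ ε, edgeSign (Function.update z w t) ε =
      ∏ u ∈ univ.filter (G.Adj w), cSign t (z u) := by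
    symm
    refine Finset.prod_nbij (fun u => s(w, u)) ?_ ?_ ?_ ?_
    · intro u hu
      simpa using hu
    · intro u _ u' _ h
      exact Sym2.congr_right.1 h
    · intro ε hε
      simp only [coe_filter, SimpleGraph.mem_edgeFinset, Set.mem_ofPred_eq] at hε
      obtain ⟨hε, u, rfl⟩ := hε
      exact ⟨u, by simpa using hε, rfl⟩
    · intro u hu
      have hwu : G.Adj w u := by simpa using hu
      rw [edgeSign_mk, Function.update_self, Function.update_of_ne hwu.ne']
  rw [h3, h3, h0, h1, h1, h2, one_mul]

/-- Every edge leaving `X` starts at `v`. Once `z v` is fixed to `i`, its sign depends on its outer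
end only, so it can be counted with the complement; replacing all values on `X` by `i` makes this
visible. -/
theorem exists_graphSign_eq_mul_of_mem (G : SimpleGraph V) {X : Set V} {v : V} (hv : v ∈ X)
    (hX : ∀ x ∈ X, ∀ y ∉ X, G.Adj x y → x = v) (i : Fin 2) :
    ∃ α β : (V → Fin 2) → ℂ, DependsOn α X ∧ DependsOn β Xᶜ ∧
      ∀ z, (if z v = i then graphSign G z else 0) = α z * β z := by
  classical
  refine ⟨fun z => if z v = i then
      ∏ ε ∈ G.edgeFinset with ∀ x ∈ ε, x ∈ X, edgeSign z ε else 0,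
    fun z => ∏ ε ∈ G.edgeFinset with ¬ ∀ x ∈ ε, x ∈ X,
      edgeSign (fun u => if u ∈ X then i else z u) ε, ?_, ?_, ?_⟩
  · intro z z' h
    simp only [h v hv]
    congr 1
    exact Finset.prod_congr rfl fun ε hε => edgeSign_congr fun x hx =>
      h x ((mem_filter.1 hε).2 x hx)
  · intro z z' h
    refine Finset.prod_congr rfl fun ε _ => edgeSign_congr fun x _ => ?_
    split_ifs with hx
    · rfl
    · exact h x hx
  · intro z
    by_cases hz : z v = i
    · simp only [hz, if_true]
      rw [graphSign, ← Finset.prod_filter_mul_prod_filter_not _ (fun ε => ∀ x ∈ ε, x ∈ X)]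
      congr 1
      refine Finset.prod_congr rfl fun ε hε => edgeSign_congr fun x hx => ?_
      split_ifs with hxX
      · rw [mem_filter, SimpleGraph.mem_edgeFinset] at hε
        obtain ⟨hε, hεX⟩ := hε
        obtain ⟨y, rfl⟩ := hx
        have hy : y ∉ X := fun hy => hεX fun u hu => by
          rcases Sym2.mem_iff.1 hu with rfl | rfl
          · exact hxX
          · exact hy
        rw [hX x hxX y hy hε, hz]
      · rfl
    · simp [hz]

/-- The cut vertex may lie on either side; if it is outside `X`, the two sides exchange roles. -/
theorem exists_graphSign_eq_mul (G : SimpleGraph V) {X : Set V} {v : V}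
    (hX : ∀ x ∈ X, ∀ y ∉ X, G.Adj x y → x = v ∨ y = v) (i : Fin 2) :
    ∃ α β : (V → Fin 2) → ℂ, DependsOn α X ∧ DependsOn β Xᶜ ∧
      ∀ z, (if z v = i then graphSign G z else 0) = α z * β z := by
  by_cases hv : v ∈ X
  · refine exists_graphSign_eq_mul_of_mem G hv (fun x hx y hy h => ?_) i
    rcases hX x hx y hy h with h' | h'
    · exact h'
    · exact absurd (h' ▸ hv) hy
  · obtain ⟨β, α, hβ, hα, h⟩ := exists_graphSign_eq_mul_of_mem G (X := Xᶜ) hv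
      (fun x hx y hy h => by
        rcases hX y (not_not.1 hy) x hx h.symm with h' | h'
        · exact absurd (h' ▸ not_not.1 hy) hv
        · exact h') i
    exact ⟨α, β, by simpa using hα, hβ, fun z => by rw [h, mul_comm]⟩

open Classical in
/-- The sign contributed by the edges between the vertex `v` and the vertices off the path. -/
noncomputable def branchSign {G : SimpleGraph V} {a b : V} (p : G.Walk a b) (z : V → Fin 2)
    (v : V) : ℂ :=
  ∏ k with k ∉ p.support ∧ G.Adj k v, cSign (z k) (z v)

open Classical in
/-- The sign contributed by the edges that do not meet the path. -/
noncomputable def offSign {G : SimpleGraph V} {a b : V} (p : G.Walk a b) (z : V → Fin 2) : ℂ :=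
  ∏ ε ∈ G.edgeFinset with ∀ v ∈ ε, v ∉ p.support, edgeSign z ε

theorem offSign_congr {G : SimpleGraph V} {a b : V} (p : G.Walk a b) {z z' : V → Fin 2}
    (h : ∀ v, v ∉ p.support → z v = z' v) : offSign p z = offSign p z' := by
  classical
  exact Finset.prod_congr rfl fun ε hε => edgeSign_congr fun v hv => h v ((mem_filter.1 hε).2 v hv)

/-- The amplitudes of the graph state of a forest, factorized with respect to a path. -/
theorem graphSign_eq_mul_of_isPath {G : SimpleGraph V} (hG : G.IsAcyclic) {a b : V}
    (p : G.Walk a b) (hp : p.IsPath) (z : V → Fin 2) :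
    graphSign G z = (p.edges.map (edgeSign z)).prod *
      (p.support.map (branchSign p z)).prod * offSign p z := by
  classical
  rw [graphSign, offSign, ← Finset.prod_filter_mul_prod_filter_not _ (fun ε => ∀ v ∈ ε, v ∉ p.support),
    mul_comm]
  congr 1
  -- Among edges meeting the path, those with both ends on it are path edges, by acyclicity; the
  -- others correspond to pairs of a path vertex and an off-path neighbour.
  rw [← Finset.prod_filter_mul_prod_filter_not _ (fun ε => ∀ v ∈ ε, v ∈ p.support)]
  congr 1
  · rw [← List.prod_toFinset _ hp.isTrail.edges_nodup]
    refine Finset.prod_congr ?_ fun _ _ => rfl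
    ext ε
    induction ε with
    | _ u v =>
    simp only [mem_filter, SimpleGraph.mem_edgeFinset, SimpleGraph.mem_edgeSet, List.mem_toFinset,
      Sym2.mem_iff, forall_eq_or_imp, forall_eq]
    constructor
    · rintro ⟨⟨h, -⟩, hu, hv⟩
      exact hG.mem_edges_of_adj_of_mem_support p hu hv h
    · intro h
      have hu := p.fst_mem_support_of_mem_edges h
      exact ⟨⟨p.adj_of_mem_edges h, fun h' => h'.1 hu⟩, hu, p.snd_mem_support_of_mem_edges h⟩
  · rw [← List.prod_toFinset _ hp.support_nodup]
    unfold branchSign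
    rw [Finset.prod_sigma']
    symm
    refine Finset.prod_nbij (fun x => s(x.2, x.1)) ?_ ?_ ?_ ?_
    · rintro ⟨v, k⟩ h
      simp only [mem_sigma, List.mem_toFinset, mem_filter, mem_univ, true_and] at h
      simp only [mem_filter, SimpleGraph.mem_edgeFinset, SimpleGraph.mem_edgeSet, Sym2.mem_iff,
        forall_eq_or_imp, forall_eq]
      tauto
    · rintro ⟨v, k⟩ h ⟨v', k'⟩ h' he
      simp only [coe_sigma, Set.mem_sigma_iff, mem_coe, List.mem_toFinset, mem_filter, mem_univ,
        true_and] at h h'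
      rcases Sym2.eq_iff.1 he with ⟨h1, h2⟩ | ⟨h1, h2⟩
      · simp only at h1 h2
        rw [h1, h2]
      · simp only at h1
        exact absurd (h1 ▸ h'.1) h.2.1
    · intro ε hε
      induction ε with
      | _ u v =>
      simp only [coe_filter, mem_filter, SimpleGraph.mem_edgeFinset, SimpleGraph.mem_edgeSet,
        Sym2.mem_iff, forall_eq_or_imp, forall_eq, Set.mem_ofPred_eq] at hε
      obtain ⟨⟨h, h1⟩, h2⟩ := hε
      by_cases hu : u ∈ p.support
      · refine ⟨⟨u, v⟩, ?_, Sym2.eq_swap⟩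
        simp only [coe_sigma, Set.mem_sigma_iff, mem_coe, List.mem_toFinset, mem_filter, mem_univ,
          true_and]
        exact ⟨hu, fun hv => h2 ⟨hu, hv⟩, h.symm⟩
      · refine ⟨⟨v, u⟩, ?_, rfl⟩
        simp only [coe_sigma, Set.mem_sigma_iff, mem_coe, List.mem_toFinset, mem_filter, mem_univ,
          true_and]
        exact ⟨by tauto, hu, h⟩
    · rintro ⟨v, k⟩ _
      rw [edgeSign_mk]

end GraphSigns

/-- Turns the path into a list of parties. The endpoints are variables constrained by equations so
that induction on the walk applies. -/
theorem support_and_edges_eq {P : Type*} {G : SimpleGraph (Option P)} {u w : Option P}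
    (p : G.Walk u w) (hp : p.IsPath) (hw : w = none) (j : P) (hu : u = some j) :
    ∃ L : List P, p.support = (j :: L).map some ++ [none] ∧ ∀ z : Option P → Fin 2,
      (p.edges.map (edgeSign z)).prod = chainSign (fun k => z (some k)) (z none) j L := by
  induction p generalizing j with
  | nil => simp [hw] at hu
  | @cons u v w h q ih =>
    subst hw hu
    cases v with
    | none =>
      rw [SimpleGraph.Walk.eq_nil_iff_nil.2 (SimpleGraph.Walk.isPath_iff_nil.1 hp.of_cons)]
      exact ⟨[], by simp, fun z => by simp [edgeSign_mk, chainSign]⟩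
    | some k =>
      obtain ⟨L, hL, hz⟩ := ih hp.of_cons rfl k rfl
      exact ⟨k :: L, by simp [hL], fun z => by simp [hz, edgeSign_mk, chainSign]⟩

/-! ## The code in terms of the graph state -/

/-- The labelling of all qubits with value `r` at the reference. -/
def withRef {P : Type*} (r : Fin 2) (y : P → Fin 2) : Option P → Fin 2 := fun o => o.elim r y

theorem eq_smul_of_ketBra_eq {ι : Type*} {φ ψ : ι → ℂ} (h : ketBra φ = ketBra ψ) {i : ι}
    (hi : ψ i ≠ 0) : ∃ c : ℂ, φ = c • ψ := by
  have h' : ∀ x y, φ x * star (φ y) = ψ x * star (ψ y) := fun x y => by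
    have := congrFun (congrFun h x) y
    simpa [ketBra, Matrix.vecMulVec_apply] using this
  have h0 : φ i ≠ 0 := fun h0 => by
    have := h' i i
    simp [h0, hi] at this
  refine ⟨star (ψ i) / star (φ i), funext fun x => ?_⟩
  have h1 : star (φ i) ≠ 0 := star_ne_zero.2 h0
  rw [Pi.smul_apply, smul_eq_mul, div_mul_eq_mul_div, eq_div_iff h1, h', mul_comm]

section CodeStates

variable {P : Type*} [Fintype P] [DecidableEq P]

theorem tensorOp_mulVec_maxEntangled (U : Option P → QubitOp) (e : Fin 2 → (P → Fin 2) → ℂ)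
    (r : Fin 2) (y : P → Fin 2) :
    (tensorOp U *ᵥ maxEntangled e) (withRef r y) =
      ((√2 : ℝ) : ℂ)⁻¹ * ∑ a, U none r a * (tensorOp (fun k => U (some k)) *ᵥ e a) y := by
  simp only [Matrix.mulVec, dotProduct, tensorOp, Matrix.of_apply, maxEntangled,
    Fintype.prod_option]
  rw [← (Equiv.piOptionEquivProd (β := fun _ : Option P => Fin 2)).symm.sum_comp,
    Fintype.sum_prod_type, Finset.mul_sum]
  refine Finset.sum_congr rfl fun a _ => ?_
  rw [Finset.mul_sum, Finset.mul_sum]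
  refine Finset.sum_congr rfl fun x _ => ?_
  simp only [Equiv.piOptionEquivProd_symm_apply, withRef, Option.elim]
  ring

/-- Reading the reference in `|r⟩` gives `∑ a, U none r a * …` equal to a multiple of the graph
amplitude; unitarity of `U none` inverts this linear system. The constant `c` absorbs the global
phase and all normalizations. -/
theorem exists_tensorOp_mulVec_eq {e : Fin 2 → (P → Fin 2) → ℂ} {G : SimpleGraph (Option P)}
    {U : Option P → QubitOp} (hU : LCTransforms U (maxEntangled e) (graphState G)) :
    ∃ c : ℂ, ∀ a y, (tensorOp (fun k => U (some k)) *ᵥ e a) y =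
      c * ∑ r, star (U none r a) * graphSign G (withRef r y) := by
  obtain ⟨hC, hU⟩ := hU
  have hg : ∃ κ : ℂ, κ ≠ 0 ∧ ∀ z, graphState G z = κ * graphSign G z :=
    ⟨∏ _v : Option P, ((√2 : ℝ) : ℂ)⁻¹, Finset.prod_ne_zero_iff.2 (by simp), fun z => by
      rw [mul_comm, graphState, graphSign]
      refine congrArg₂ _ (Finset.prod_congr (by congr!) fun ε _ => ?_) rfl
      unfold edgeSign
      congr!⟩
  obtain ⟨κ, hκ, hg⟩ := hg
  have h0 : graphState G (fun _ => 0) ≠ 0 := by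
    rw [hg]
    refine mul_ne_zero hκ (Finset.prod_ne_zero_iff.2 fun ε _ => ?_)
    rw [edgeSign]
    split_ifs <;> simp
  have hk : ketBra (tensorOp U *ᵥ maxEntangled e) = ketBra (graphState G) := by
    rw [← hU, ketBra, ketBra, Matrix.star_mulVec, Matrix.mul_vecMulVec, Matrix.vecMulVec_mul]
  obtain ⟨c, hc⟩ := eq_smul_of_ketBra_eq hk h0
  refine ⟨((√2 : ℝ) : ℂ) * c * κ, fun a y => ?_⟩
  have hr : ∀ r, ∑ b, U none r b * (tensorOp (fun k => U (some k)) *ᵥ e b) y =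
      ((√2 : ℝ) : ℂ) * c * κ * graphSign G (withRef r y) := by
    intro r
    have h1 := congrFun hc (withRef r y)
    rw [tensorOp_mulVec_maxEntangled, Pi.smul_apply, hg, smul_eq_mul] at h1
    have h2 : ((√2 : ℝ) : ℂ) ≠ 0 := by simp
    rw [inv_mul_eq_iff_eq_mul₀ h2] at h1
    rw [h1]
    ring
  have hUU : ∀ b, ∑ r, star (U none r a) * U none r b = if b = a then 1 else 0 := by
    intro b
    have := congrFun (congrFun (hC none).conjTranspose_mul_self a) b
    simp only [Matrix.mul_apply, Matrix.conjTranspose_apply, Matrix.one_apply] at this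
    rw [this]
    simp only [eq_comm]
  calc (tensorOp (fun k => U (some k)) *ᵥ e a) y
      = ∑ b, (∑ r, star (U none r a) * U none r b) *
          (tensorOp (fun k => U (some k)) *ᵥ e b) y := by
        simp only [hUU, ite_mul, one_mul, zero_mul, Finset.sum_ite_eq', mem_univ, if_true]
    _ = ∑ r, star (U none r a) *
          ∑ b, U none r b * (tensorOp (fun k => U (some k)) *ᵥ e b) y := by
        simp only [Finset.sum_mul, Finset.mul_sum]
        rw [Finset.sum_comm]
        simp only [mul_assoc]
    _ = _ := by
        simp only [hr, Finset.mul_sum]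
        exact Finset.sum_congr rfl fun r _ => by ring

/-! ### Gates of all parties -/

/-- Parties outside `C` may be imagined to apply their unitaries first: these commute with `Λ`, are
invertible, and `T` is stable under their local operators. -/
theorem allLeaves_of_applyGates {d : ℕ} {T : (Fin 2 → (P → LocalSys d) → ℂ) → Prop}
    {C : Finset P} (hT : ∀ k ∉ C, ∀ A ψ, T ψ → T fun a => localOp k A *ᵥ ψ a)
    {A : P → QubitOp} (hA : ∀ k, (A k)ᴴ * A k = 1) {Λ : Protocol P (LocalSys d)}
    (hΛ : Λ.IsLOCC C) (L : List P) (hL : ∀ k ∈ L, k ∉ C) (ψ : Fin 2 → (P → Fin 2) → ℂ)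
    (h : Λ.AllLeaves T fun a => liftVec d (applyGates A L (ψ a))) :
    Λ.AllLeaves T fun a => liftVec d (ψ a) := by
  induction L generalizing ψ with
  | nil => exact h
  | cons v L ih =>
    rw [List.forall_mem_cons] at hL
    have h1 := ih hL.2 (fun a => localOp v (A v) *ᵥ ψ a) h
    simp only [← localOp_kronecker_mulVec_liftVec] at h1
    refine Protocol.allLeaves_of_localOp hL.1 (hT v hL.1)
      (B := Matrix.kronecker (A v)ᴴ (1 : Matrix (Fin (d + 1)) (Fin (d + 1)) ℂ)) ?_ Λ hΛ _ h1
    simp only [Matrix.kronecker]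
    rw [← Matrix.mul_kronecker_mul, hA v, one_mul]
    exact Matrix.one_kronecker_one

/-- After the gates of the parties in `C` one may continue as if all parties had applied theirs. -/
theorem allLeaves_gates_of_tensorOp {d : ℕ} {T : (Fin 2 → (P → LocalSys d) → ℂ) → Prop}
    {C : Finset P} (hT : ∀ k ∉ C, ∀ A ψ, T ψ → T fun a => localOp k A *ᵥ ψ a)
    {A : P → QubitOp} (hA : ∀ k, (A k)ᴴ * A k = 1) {next : Protocol P (LocalSys d)}
    (hnext : next.IsLOCC C) (ψ : Fin 2 → (P → Fin 2) → ℂ)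
    (h : next.AllLeaves T fun a => liftVec d (tensorOp A *ᵥ ψ a)) :
    (ExtractionAlgorithm.gates A C.toList next).AllLeaves T fun a => liftVec d (ψ a) := by
  refine allLeaves_of_applyGates hT hA
    (ExtractionAlgorithm.isLOCC_gates (fun k hk => mem_toList.1 hk) hA hnext) Cᶜ.toList
    (fun k hk => mem_compl.1 (mem_toList.1 hk)) ψ ?_
  rw [ExtractionAlgorithm.allLeaves_gates]
  have hnd : (Cᶜ.toList ++ C.toList).Nodup := by
    rw [List.nodup_append']
    refine ⟨nodup_toList _, nodup_toList _, fun k hk hk' => ?_⟩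
    exact mem_compl.1 (mem_toList.1 hk) (mem_toList.1 hk')
  have hmem : ∀ k, k ∈ Cᶜ.toList ++ C.toList := fun k => by
    by_cases hk : k ∈ C <;> simp [hk]
  simpa only [applyGates_append_eq_tensorOp A _ _ hnd hmem] using h

end CodeStates

/-! ## The extraction algorithm extracts -/

theorem mem_pathNbhd_iff {P : Type*} [Fintype P] {G : SimpleGraph (Option P)} {u w : Option P} (p : G.Walk u w) (x : Option P) :
    x ∈ pathNbhd p ↔ ∃ l ∈ p.support, G.Adj x l := by
  simp [pathNbhd]

section Algorithm

variable {P : Type*} [Fintype P] [DecidableEq P] {G : SimpleGraph (Option P)}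

/-- Each neighbour with outcome `1` contributes one sign `cSign 1 (z v)`, that is, one `Z` at `v`.
-/
theorem branchSign_eq_pow_outcomeCount {u w : Option P} (p : G.Walk u w)
    (hw : none ∈ p.support) (s : P → Fin 2) (z : Option P → Fin 2)
    (hz : ∀ k, some k ∉ p.support → (∃ v ∈ p.support, G.Adj (some k) v) → z (some k) = s k)
    {v : Option P} (hv : v ∈ p.support) :
    branchSign p z v = cSign 1 (z v) ^ ExtractionAlgorithm.outcomeCount p s v := by
  classical
  rw [branchSign, Finset.prod_filter, Fintype.prod_option, if_neg (fun h => h.1 hw), one_mul,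
    ExtractionAlgorithm.outcomeCount, ← Finset.prod_const, Finset.prod_filter]
  refine Finset.prod_congr rfl fun k _ => ?_
  by_cases h : some k ∉ p.support ∧ G.Adj (some k) v
  · rw [if_pos h, hz k h.1 ⟨v, hv, h.2⟩]
    by_cases hs : s k = 1
    · rw [if_pos ⟨h.1, h.2, hs⟩, hs]
    · have : s k = 0 := by omega
      rw [if_neg (fun h => hs h.2.2), this, cSign_zero_left]
  · rw [if_neg h, if_neg (fun h' => h ⟨h'.1, h'.2.1⟩)]

theorem reduceOption_map_some {α : Type*} (L : List α) :
    (L.map some ++ [none]).reduceOption = L := by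
  induction L with
  | nil => rfl
  | cons a L ih => rw [List.map_cons, List.cons_append, List.reduceOption_cons_of_some, ih]

theorem extracts_protocol {S : Subgroup (Matrix (P → Fin 2) (P → Fin 2) ℂ)ˣ}
    {e : Fin 2 → (P → Fin 2) → ℂ} (he : IsLogicalBasis S e) (hG : G.IsAcyclic)
    {U : Option P → QubitOp} (hU : LCTransforms U (maxEntangled e) (graphState G))
    {j : P} (p : G.Walk (some j) none) (hp : p.IsPath) (d : ℕ) :
    Extracts e j (Finset.eraseNone (pathNbhd p)) (ExtractionAlgorithm.protocol U p d) := by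
  classical
  -- The protocol was defined with classical decidability, so the given instance is identified with
  -- it.
  obtain rfl : ‹DecidableEq P› = fun a b => Classical.propDecidable (a = b) :=
    Subsingleton.elim _ _
  rw [ExtractionAlgorithm.protocol]
  generalize hN : Finset.filter (fun k => some k ∉ p.support) (eraseNone (pathNbhd p)) = N
  replace hN : ∀ k, k ∈ N.toList ↔ k ∈ eraseNone (pathNbhd p) ∧ some k ∉ p.support := fun k => by
    rw [mem_toList, ← hN, mem_filter]
  have hW : ∀ k, some k ∈ p.support → k ∈ eraseNone (pathNbhd p) := fun k hk => by
    rw [mem_eraseNone, mem_pathNbhd_iff]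
    exact p.exists_adj_mem_support (SimpleGraph.Walk.not_nil_of_ne (by simp)) hk
  have hj : j ∈ eraseNone (pathNbhd p) := hW j p.start_mem_support
  obtain ⟨L, hL, hz⟩ := support_and_edges_eq p hp rfl j rfl
  have hred : p.support.reduceOption = j :: L := by rw [hL, reduceOption_map_some]
  have hmemL : ∀ k, k ∈ j :: L ↔ some k ∈ p.support := fun k => by simp [hL]
  have hnd : (j :: L).Nodup := by
    have := hp.support_nodup
    rw [hL] at this
    exact (List.nodup_append.1 this).1.of_map
  have hnone : none ∈ p.support := p.end_mem_support
  have hA : ∀ k, (U (some k))ᴴ * U (some k) = 1 := fun k => (hU.1 _).conjTranspose_mul_self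
  have hin : ∀ s, (ExtractionAlgorithm.gates
      (fun k => pauliZ ^ ExtractionAlgorithm.outcomeCount p s (some k)) p.support.reduceOption <|
        ExtractionAlgorithm.alongPath (d := d) j (U none)
          (ExtractionAlgorithm.outcomeCount p s none)
          p.support.reduceOption.tail).IsLOCC (eraseNone (pathNbhd p)) := fun s => by
    rw [hred]
    refine ExtractionAlgorithm.isLOCC_gates (fun k hk => hW k ((hmemL k).1 hk))
      (fun k => ExtractionAlgorithm.isometry_pauliZ_pow _) ?_
    exact ExtractionAlgorithm.isLOCC_alongPath hj (hU.1 none).self_mul_conjTranspose _ _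
      fun k hk => hW k ((hmemL k).1 (List.mem_cons_of_mem _ hk))
  have hin' := ExtractionAlgorithm.isLOCC_measureAllZ
    (L := N.toList)
    (fun k hk => ((hN k).1 hk).1) (s := fun _ => 0) hin
  refine extracts_of_allLeaves he hj
    (ExtractionAlgorithm.isLOCC_gates (fun k hk => mem_toList.1 hk) hA hin') ?_
  refine allLeaves_gates_of_tensorOp (T := IsDecoded j)
    (fun k hk A ψ hψ => hψ.localOp (by rintro rfl; exact hk hj) A) hA hin' e ?_
  refine ExtractionAlgorithm.allLeaves_measureAllZ _ (nodup_toList _) _ _ _ fun s => ?_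
  rw [ExtractionAlgorithm.allLeaves_gates, hred, List.tail_cons]
  obtain ⟨c, hc⟩ := exists_tensorOp_mulVec_eq hU
  refine ExtractionAlgorithm.allLeaves_alongPath (hU.1 none).conjTranspose_mul_self _ L hnd
    -- The prefactor independent of the path qubits: the recorded outcomes and the edges off the
    -- path. The reference lies on the path, so its value in `offSign` can be set to `0`.
    (fun y => (if ∀ k ∈ N.toList,
      y k = s k then c else 0) *
        offSign p (withRef 0 y)) ?_ _ ?_
  · intro k hk y i
    rw [hmemL] at hk
    congr 1
    · congr 1
      refine propext (forall₂_congr fun l hl => ?_)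
      rw [Function.update_of_ne]
      rintro rfl
      exact ((hN _).1 hl).2 hk
    · refine offSign_congr p fun v hv => ?_
      cases v with
      | none => rfl
      | some l =>
        have hlk : l ≠ k := by rintro rfl; exact hv hk
        exact Function.update_of_ne hlk _ _
  · intro a y
    rw [ExtractionAlgorithm.applyGates_pauliZ_pow]
    by_cases hy : ∀ k ∈ N.toList,
        y k = s k
    · simp only [if_pos hy]
      rw [hc]
      simp only [Finset.mul_sum]
      refine Finset.sum_congr rfl fun r _ => ?_
      have hyz : ∀ k, some k ∉ p.support → (∃ v ∈ p.support, G.Adj (some k) v) →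
          withRef r y (some k) = s k := fun k hk hk' => by
        refine hy k ((hN k).2 ⟨?_, hk⟩)
        rwa [mem_eraseNone, mem_pathNbhd_iff]
      rw [graphSign_eq_mul_of_isPath hG p hp, hz,
        List.map_congr_left fun v hv => branchSign_eq_pow_outcomeCount p hnone s _ hyz hv]
      have hoff : offSign p (withRef r y) = offSign p (withRef 0 y) :=
        offSign_congr p fun v hv => by
          cases v with
          | none => exact absurd hnone hv
          | some l => rfl
      rw [hoff]
      have hsq : ∀ M : List P,
          (M.map fun k => cSign 1 (y k) ^ ExtractionAlgorithm.outcomeCount p s (some k)).prod *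
          (M.map fun k => cSign 1 (y k) ^ ExtractionAlgorithm.outcomeCount p s (some k)).prod =
            1 := by
        intro M
        rw [← List.prod_map_mul]
        simp only [← mul_pow, cSign_mul_self, one_pow]
        simp
      rw [show (p.support.map fun v => cSign 1 (withRef r y v) ^
          ExtractionAlgorithm.outcomeCount p s v).prod =
          ((j :: L).map fun k => cSign 1 (y k) ^
            ExtractionAlgorithm.outcomeCount p s (some k)).prod *
              cSign 1 r ^ ExtractionAlgorithm.outcomeCount p s none by
        rw [hL, List.map_append, List.prod_append, List.map_map]
        simp [withRef, Function.comp_def]]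
      change _ * (c * (_ * (chainSign y r j L * _ * _))) = _
      linear_combination (c * star (U none r a) * chainSign y r j L *
        cSign 1 r ^ ExtractionAlgorithm.outcomeCount p s none *
        offSign p (withRef 0 y)) * hsq (j :: L)
    · simp only [if_neg hy, mul_zero, zero_mul]

end Algorithm

/-! ## Parties needed for extraction -/

/-- Projecting the graph state at a cut vertex leaves a product family. -/
theorem isProductFamily_graphSign {P : Type*} [Fintype P] {G : SimpleGraph (Option P)} {X : Set (Option P)}
    (hX : none ∈ X) {v : Option P}
    (hcut : ∀ x ∈ X, ∀ y ∉ X, G.Adj x y → x = v ∨ y = v) (i : Fin 2) (c : ℂ)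
    (g : Fin 2 → Fin 2 → ℂ) :
    IsProductFamily {k | some k ∈ X} fun a y =>
      c * ∑ r, g r a * if withRef r y v = i then graphSign G (withRef r y) else 0 := by
  obtain ⟨α, β, hα, hβ, h⟩ := exists_graphSign_eq_mul G hcut i
  refine ⟨fun a y => c * ∑ r, g r a * α (withRef r y), fun y => β (withRef 0 y),
    fun a x y hxy => ?_, fun x y hxy => ?_, fun a y => ?_⟩
  · have : ∀ r, α (withRef r x) = α (withRef r y) := fun r => hα fun o ho => by
      cases o with
      | none => rfl
      | some k => exact hxy k ho
    simp only [this]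
  · refine hβ fun o ho => ?_
    cases o with
    | none => exact absurd hX ho
    | some k => exact hxy k ho
  · have : ∀ r, β (withRef r y) = β (withRef 0 y) := fun r => hβ fun o ho => by
      cases o with
      | none => exact absurd hX ho
      | some k => rfl
    simp only [h, this, Finset.mul_sum, Finset.sum_mul, mul_assoc]

theorem IsProductFamily.liftVec {P : Type*} [Fintype P] {A : Set P} {ψ : Fin 2 → (P → Fin 2) → ℂ} (d : ℕ)
    (h : IsProductFamily A ψ) : IsProductFamily A fun a => liftVec d (ψ a) := by
  classical
  obtain ⟨α, β, hα, hβ, h⟩ := h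
  refine ⟨fun a x => if ∀ k ∈ A, (x k).2 = 0 then α a fun k => (x k).1 else 0,
    fun x => if ∀ k ∈ Aᶜ, (x k).2 = 0 then β fun k => (x k).1 else 0, fun a x y hxy => ?_,
    fun x y hxy => ?_, fun a x => ?_⟩
  · have h1 : (∀ k ∈ A, (x k).2 = 0) ↔ ∀ k ∈ A, (y k).2 = 0 :=
      forall₂_congr fun k hk => by rw [hxy k hk]
    have h2 : α a (fun k => (x k).1) = α a fun k => (y k).1 :=
      hα a fun k hk => by rw [hxy k hk]
    simp only [h1, h2]
  · have h1 : (∀ k ∈ Aᶜ, (x k).2 = 0) ↔ ∀ k ∈ Aᶜ, (y k).2 = 0 :=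
      forall₂_congr fun k hk => by rw [hxy k hk]
    have h2 : β (fun k => (x k).1) = β fun k => (y k).1 := hβ fun k hk => by rw [hxy k hk]
    simp only [h1, h2]
  · have h1 : (∀ k, (x k).2 = 0) ↔ (∀ k ∈ A, (x k).2 = 0) ∧ ∀ k ∈ Aᶜ, (x k).2 = 0 :=
      ⟨fun h => ⟨fun k _ => h k, fun k _ => h k⟩, fun h k => by
        by_cases hk : k ∈ A
        · exact h.1 k hk
        · exact h.2 k hk⟩
    simp only [_root_.liftVec, h]
    by_cases hA : ∀ k ∈ A, (x k).2 = 0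
    · by_cases hA' : ∀ k ∈ Aᶜ, (x k).2 = 0
      · rw [if_pos (h1.2 ⟨hA, hA'⟩), if_pos hA, if_pos hA']
      · rw [if_neg (fun h => hA' (h1.1 h).2), if_neg hA', mul_zero]
    · rw [if_neg (fun h => hA (h1.1 h).1), if_neg hA, zero_mul]

section LowerBound

variable {P : Type*} [Fintype P] [DecidableEq P]

/-- Conditioning on recorded outcomes is a succession of local projectors. -/
theorem IsProductFamily.ite_forall_mem {A : Set P} {ψ : Fin 2 → (P → Fin 2) → ℂ}
    (h : IsProductFamily A ψ) (L : List P) (s : P → Fin 2) :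
    IsProductFamily A fun a x => if ∀ k ∈ L, x k = s k then ψ a x else 0 := by
  induction L with
  | nil => simpa using h
  | cons v L ih =>
    convert ih.localOp v (![!![1, 0; 0, 0], !![0, 0; 0, 1]] (s v)) using 1
    funext a x
    rw [ExtractionAlgorithm.localOp_project_mulVec]
    simp only [List.forall_mem_cons]
    split_ifs <;> tauto

theorem Protocol.IsLOCC.mono {P Q : Type*} [Fintype Q] [DecidableEq Q] {C D : Finset P}
    (hCD : C ⊆ D) {Λ : Protocol P Q} (h : Λ.IsLOCC C) : Λ.IsLOCC D := by
  induction Λ with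
  | done => trivial
  | step k m K next ih => exact ⟨hCD h.1, h.2.1, fun i => ih i (h.2.2 i)⟩

/-- The other parties prevent extraction by their Clifford gates followed by a protocol that
leaves product states. -/
theorem not_canExtract_of_allLeaves {e : Fin 2 → (P → Fin 2) → ℂ} {j : P} {C T : Finset P}
    {A : Set P} (hj : j ∉ A) {U : P → QubitOp} (hU : ∀ k, (U k)ᴴ * U k = 1) (hT : T ⊆ Cᶜ)
    (Γ : ∀ d, Protocol P (LocalSys d)) (hΓ : ∀ d, (Γ d).IsLOCC T)
    (h : ∀ d, (Γ d).AllLeaves (IsProductFamily A) fun a => liftVec d (tensorOp U *ᵥ e a)) :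
    ¬ CanExtract e j C := by
  rintro ⟨d, Λ, hΛ⟩
  refine not_extracts_of_allLeaves hj (Γ := ExtractionAlgorithm.gates U T.toList (Γ d)) ?_ ?_ Λ hΛ
  · exact (ExtractionAlgorithm.isLOCC_gates (fun k hk => mem_toList.1 hk) hU (hΓ d)).mono hT
  · exact allLeaves_gates_of_tensorOp (T := IsProductFamily A) (fun k _ B ψ hψ => hψ.localOp k B)
      hU (hΓ d) e (h d)

variable {e : Fin 2 → (P → Fin 2) → ℂ} {G : SimpleGraph (Option P)} {U : Option P → QubitOp}
  {j : P}

/-- Otherwise `v` measures in the `Z` basis; this cuts the tree there and leaves a product across a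
cut between `j` and the reference. -/
theorem CanExtract.mem_of_mem_support {C : Finset P} (hC : CanExtract e j C) (hG : G.IsAcyclic)
    (hU : LCTransforms U (maxEntangled e) (graphState G)) (p : G.Walk (some j) none)
    (hp : p.IsPath) {v : P} (hv : some v ∈ p.support) : v ∈ C := by
  by_contra hvC
  obtain ⟨X, hX, hjX, hcut⟩ := hG.exists_separating_set (by simp) p hp hv
  obtain ⟨c, hc⟩ := exists_tensorOp_mulVec_eq hU
  refine not_canExtract_of_allLeaves (A := {k | some k ∈ X}) (T := {v}) hjX
    (fun k => (hU.1 (some k)).conjTranspose_mul_self) (by simpa using hvC)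
    (fun d => ExtractionAlgorithm.measureAllZ [v] (fun _ => 0) fun _ => .done) (fun d => ?_)
    (fun d => ?_) hC
  · exact ExtractionAlgorithm.isLOCC_measureAllZ (by simp) fun _ => trivial
  · refine ExtractionAlgorithm.allLeaves_measureAllZ _ (by simp) _ _ _ fun s => ?_
    have := (isProductFamily_graphSign hX hcut (s v) c fun r a => star (U none r a)).liftVec d
    change IsProductFamily _ _
    convert this using 3 with a
    funext y
    have hy : ∀ r, withRef r y (some v) = s v ↔ y v = s v := fun _ => Iff.rfl
    simp only [List.mem_singleton, forall_eq, hc, hy]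
    by_cases h : y v = s v
    · simp only [if_pos h]
    · simp only [if_neg h, mul_zero, Finset.sum_const_zero]

theorem cSign_add (t a b : Fin 2) : cSign t (a + b) = cSign t a * cSign t b := by
  rw [cSign_comm, cSign_comm t a, cSign_comm t b]
  fin_cases a <;> fin_cases b <;> fin_cases t <;> simp [cSign]

/-- Neighbours with definite values act on a vertex as one bit, their parity `σ`. -/
theorem exists_prod_cSign_eq {ι : Type*} (N : Finset ι) (s : ι → Fin 2) :
    ∃ σ : Fin 2, ∀ t, ∏ k ∈ N, cSign t (s k) = cSign t σ := by
  classical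
  induction N using Finset.induction_on with
  | empty => exact ⟨0, fun t => by rw [cSign_comm, cSign_zero_left, Finset.prod_empty]⟩
  | insert k N hk ih =>
    obtain ⟨σ, h⟩ := ih
    exact ⟨s k + σ, fun t => by rw [Finset.prod_insert hk, h, cSign_add]⟩

/-- A measurement in the basis `|±⟩` of a vertex `w`, all neighbours of which but `v` have
definite values, projects `v` onto a definite value as well. -/
theorem isProductFamily_measureX {G : SimpleGraph (Option P)} {X : Set (Option P)}
    (hX : none ∈ X) {v : Option P}
    (hcut : ∀ x ∈ X, ∀ y ∉ X, G.Adj x y → x = v ∨ y = v) {w : P} (hvw : G.Adj (some w) v)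
    (N : Finset P) (hN : ∀ k, k ∈ N ↔ G.Adj (some w) (some k) ∧ some k ≠ v)
    (hnone : G.Adj (some w) none → none = v) (s : P → Fin 2) (c : ℂ) (g : Fin 2 → Fin 2 → ℂ)
    (q : Fin 2) (B : QubitOp) (hB : ∀ a b, B a b = 2⁻¹ * cSign q (a + b)) :
    IsProductFamily {k | some k ∈ X} fun a => localOp w B *ᵥ
      fun y => if ∀ k ∈ N.toList, y k = s k then
        c * ∑ r, g r a * graphSign G (withRef r y) else 0 := by
  classical
  obtain ⟨σ, hσ⟩ := exists_prod_cSign_eq N s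
  have hwN : w ∉ N := fun h => G.loopless.irrefl _ ((hN w).1 h).1
  have hnbr : univ.filter (G.Adj (some w)) = insert v (N.map Function.Embedding.some) := by
    ext o
    simp only [mem_filter, mem_univ, true_and, mem_insert, mem_map, Function.Embedding.some_apply]
    cases o with
    | none =>
      simp only [reduceCtorEq, and_false, exists_false, or_false]
      exact ⟨hnone, fun h => h ▸ hvw⟩
    | some k =>
      simp only [Option.some.injEq, exists_eq_right, hN]
      constructor
      · intro h
        by_cases hk : some k = v
        · exact Or.inl hk
        · exact Or.inr ⟨h, hk⟩
      · rintro (h | h)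
        · exact h ▸ hvw
        · exact h.1
  have hvN : v ∉ N.map Function.Embedding.some := by
    simp only [mem_map, Function.Embedding.some_apply, not_exists, not_and]
    rintro k hk rfl
    exact ((hN k).1 hk).2 rfl
  have hup : ∀ r t (y : P → Fin 2),
      withRef r (Function.update y w t) = Function.update (withRef r y) (some w) t := by
    intro r t y
    funext o
    cases o with
    | none => simp [withRef]
    | some k =>
      by_cases hk : k = w
      · subst hk; simp [withRef]
      · rw [Function.update_of_ne (by simpa using hk)]
        exact Function.update_of_ne hk _ _
  -- Summing over the value `t` of `w` gives `cSign q (y w)` times half the sum of `(-1) ^ (t * (q +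
  -- σ + z v))`, which vanishes unless `z v = q + σ`. What survives is the amplitude with `w` set to
  -- `0`, which the matrix here reads off.
  have key := ((isProductFamily_graphSign hX hcut (q + σ) c g).localOp w
    (Matrix.of fun a b => if b = 0 then cSign q a else 0)).ite_forall_mem N.toList s
  convert key using 1
  funext a y
  rw [localOp_mulVec, localOp_mulVec]
  have hyN : ∀ t, (∀ k ∈ N.toList, Function.update y w t k = s k) ↔ ∀ k ∈ N.toList, y k = s k :=
    fun t => forall₂_congr fun k hk => by
      rw [Function.update_of_ne]
      rintro rfl
      exact hwN (mem_toList.1 hk)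
  simp only [hyN]
  by_cases hy : ∀ k ∈ N.toList, y k = s k
  · simp only [if_pos hy, hB, Matrix.of_apply, ite_mul, zero_mul, Finset.sum_ite_eq', mem_univ, if_true]
    simp only [Finset.mul_sum]
    rw [Finset.sum_comm]
    refine Finset.sum_congr rfl fun r _ => ?_
    have hsign : ∀ t, graphSign G (withRef r (Function.update y w t)) =
        cSign t (withRef r y v) * cSign t σ *
          graphSign G (withRef r (Function.update y w 0)) := by
      intro t
      rw [hup, hup, graphSign_update, hnbr, Finset.prod_insert hvN, Finset.prod_map, ← hσ]
      congr 2
      exact Finset.prod_congr rfl fun k hk => by rw [← hy k (mem_toList.2 hk)]; rfl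
    have hv0 : withRef r (Function.update y w 0) v = withRef r y v := by
      rw [hup, Function.update_of_ne hvw.ne']
    rw [Fin.sum_univ_two, hsign 1, hv0]
    generalize graphSign G (withRef r (Function.update y w 0)) = γ
    generalize withRef r y v = b
    generalize y w = a'
    rw [cSign_add, cSign_add]
    clear key hsign hv0 hB hσ
    fin_cases q <;> fin_cases σ <;> fin_cases b <;> fin_cases a' <;> simp [cSign] <;> ring
  · simp only [if_neg hy, mul_zero, Finset.sum_const_zero]

/-- Otherwise `w` and all its neighbours except `v` are free to act against the extraction. The
neighbours measure `Z`, then `w` measures `X`; this amounts to a `Z` measurement at `v`, possible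
even when `v` belongs to `C` or is the reference. -/
theorem CanExtract.exists_mem_of_adj {C : Finset P} (hC : CanExtract e j C) (hG : G.IsAcyclic)
    (hU : LCTransforms U (maxEntangled e) (graphState G)) (p : G.Walk (some j) none)
    (hp : p.IsPath) {w : P} (hw : some w ∉ p.support) {v : Option P} (hv : v ∈ p.support)
    (hvw : G.Adj (some w) v) :
    ∃ u ∈ C, some u ∉ p.support ∧ (some u = some w ∨ G.Adj (some w) (some u)) := by
  classical
  by_contra! hno
  obtain ⟨X, hX, hjX, hcut⟩ := hG.exists_separating_set (by simp) p hp hv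
  obtain ⟨c, hc⟩ := exists_tensorOp_mulVec_eq hU
  let N : Finset P := univ.filter fun k => G.Adj (some w) (some k) ∧ some k ≠ v
  have hN : ∀ k, k ∈ N ↔ G.Adj (some w) (some k) ∧ some k ≠ v := fun k => by simp [N]
  have hoff : ∀ k ∈ N, some k ∉ p.support := fun k hk hk' =>
    ((hN k).1 hk).2 (hG.eq_of_adj_of_mem_support p hw hk' hv ((hN k).1 hk).1 hvw)
  have hNT : ∀ k ∈ N.toList, k ∈ insert w N := fun k hk =>
    mem_insert_of_mem (mem_toList.1 hk)
  refine not_canExtract_of_allLeaves (A := {k | some k ∈ X}) (T := insert w N) hjX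
    (fun k => (hU.1 (some k)).conjTranspose_mul_self) ?_
    (fun d => ExtractionAlgorithm.measureAllZ N.toList (fun _ => 0) fun _ =>
      ExtractionAlgorithm.measureX w ![.done, .done]) (fun d => ?_) (fun d => ?_) hC
  · intro k hk
    rw [mem_compl]
    intro hkC
    rcases mem_insert.1 hk with rfl | hk
    · exact (hno k hkC hw).1 rfl
    · exact (hno k hkC (hoff k hk)).2 ((hN k).1 hk).1
  · refine ExtractionAlgorithm.isLOCC_measureAllZ hNT fun _ => ?_
    refine ExtractionAlgorithm.isLOCC_measureX (mem_insert_self _ _) fun i => ?_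
    fin_cases i <;> trivial
  · refine ExtractionAlgorithm.allLeaves_measureAllZ _ (nodup_toList _) _ _ _ fun s => ?_
    simp only [hc]
    rw [ExtractionAlgorithm.allLeaves_measureX]
    have hprod := isProductFamily_measureX hX hcut hvw N hN
      (fun h => hG.eq_of_adj_of_mem_support p hw p.end_mem_support hv h hvw) s c
      fun r a => star (U none r a)
    constructor
    · refine (hprod 0 _ fun a b => ?_).liftVec d
      fin_cases a <;> fin_cases b <;> simp [cSign]
    · refine (hprod 1 _ fun a b => ?_).liftVec d
      fin_cases a <;> fin_cases b <;> simp [cSign]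

/-- Each path party represents itself, and each off-path `w` is represented by a member of `C` in
its star. Representatives on and off the path differ, and stars of different `w` do not meet, so the
choice is injective. -/
theorem CanExtract.card_le {C : Finset P} (hC : CanExtract e j C) (hG : G.IsAcyclic)
    (hU : LCTransforms U (maxEntangled e) (graphState G)) (p : G.Walk (some j) none)
    (hp : p.IsPath) : (eraseNone (pathNbhd p)).card ≤ C.card := by
  classical
  have hex : ∀ w : P, w ∈ eraseNone (pathNbhd p) → ∃ u ∈ C,
      (some w ∈ p.support → u = w) ∧ (some w ∉ p.support → some u ∉ p.support ∧
        (some u = some w ∨ G.Adj (some w) (some u))) := by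
    intro w hw
    by_cases hwp : some w ∈ p.support
    · exact ⟨w, hC.mem_of_mem_support hG hU p hp hwp, fun _ => rfl, fun h => absurd hwp h⟩
    · rw [mem_eraseNone, mem_pathNbhd_iff] at hw
      obtain ⟨v, hv, hvw⟩ := hw
      obtain ⟨u, hu, h⟩ := hC.exists_mem_of_adj hG hU p hp hwp hv hvw
      exact ⟨u, hu, fun h => absurd h hwp, fun _ => h⟩
  choose! f hfC hfon hfoff using hex
  refine Finset.card_le_card_of_injOn f hfC fun w hw w' hw' hff => ?_
  by_cases h : some w ∈ p.support <;> by_cases h' : some w' ∈ p.support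
  · rw [← hfon w hw h, hff, hfon w' hw' h']
  · refine absurd ?_ (hfoff w' hw' h').1
    rw [← hff, hfon w hw h]
    exact h
  · refine absurd ?_ (hfoff w hw h).1
    rw [hff, hfon w' hw' h']
    exact h'
  · obtain ⟨v, hv, hwv⟩ := (mem_pathNbhd_iff p _).1 (mem_eraseNone.1 hw)
    obtain ⟨v', hv', hwv'⟩ := (mem_pathNbhd_iff p _).1 (mem_eraseNone.1 hw')
    have := hfoff w' hw' h'
    rw [← hff] at this
    exact Option.some.inj (hG.eq_of_common_neighbor p h h' (hfoff w hw h).1 hv hv' hwv hwv'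
      (hfoff w hw h).2 this.2)

end LowerBound

theorem theorem2 {P : Type*} [Fintype P] [DecidableEq P]
    (S : Subgroup (Matrix (P → Fin 2) (P → Fin 2) ℂ)ˣ)
    (e : Fin 2 → (P → Fin 2) → ℂ) (he : IsLogicalBasis S e)
    (G : SimpleGraph (Option P)) (hG : G.IsTree)
    (U : Option P → QubitOp) (hU : LCTransforms U (maxEntangled e) (graphState G))
    (j : P) (p : G.Walk (some j) none) (hp : p.IsPath) :
    IsLeast {m : ℕ | ∃ C : Finset P, CanExtract e j C ∧ C.card = m}
        (Finset.eraseNone (pathNbhd p)).card ∧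
      (pathNbhd p).card = (Finset.eraseNone (pathNbhd p)).card + 1 ∧
      ∀ d : ℕ, Extracts e j (Finset.eraseNone (pathNbhd p))
        (ExtractionAlgorithm.protocol U p d) := by
  have hmain := extracts_protocol he hG.isAcyclic hU p hp
  -- With `d = 0` the ancillas are one-dimensional: the minimum is attained without real ancillas,
  -- while the lower bound allows any.
  refine ⟨⟨⟨_, ⟨0, _, hmain 0⟩, rfl⟩, ?_⟩, ?_, hmain⟩
  · rintro m ⟨C, hC, rfl⟩
    exact hC.card_le hG.isAcyclic hU p hp
  · have hnone : none ∈ pathNbhd p := by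
      rw [mem_pathNbhd_iff]
      exact p.exists_adj_mem_support (SimpleGraph.Walk.not_nil_of_ne (by simp)) p.end_mem_support
    have hpos := Finset.card_pos.2 ⟨_, hnone⟩
    rw [Finset.card_eraseNone_of_mem hnone]
    omega
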